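/- Let $\mathcal A$ be a (real or complex, not necessarily unital) Banach algebra. For $f\in\mathcal A^*$ and $a\in\mathcal A$ define $f\cdot a,\ a\cdot f\in\mathcal A^*$ by $\langle f\cdot a,b\rangle=\langle f,ab\rangle$ and $\langle a\cdot f,b\rangle=\langle f,ba\rangle$ for $b\in\mathcal A$. Let $\mathcal{WAP}(\mathcal A)$ be the subspace of all $f\in\mathcal A^*$ that are weakly almost periodic, that is, for which $\{f\cdot a:\|a\|\le 1\}$ is relatively weakly compact in $\mathcal A^*$; it carries the norm of $\mathcal A^*$. A linear map $T:X\to Y$ between normed spaces is bounded below if there is a constant $c>0$ with $\|Tx\|\ge c\|x\|$ for all $x\in X$. The Banach algebra $\mathcal A$ is a $\mathcal{WAP}$-algebra if the natural map $\mathcal A\to\mathcal{WAP}(\mathcal A)^*$, $a\mapsto(f\mapsto f(a))$, is bounded below. A dual Banach algebra is a Banach algebra $\mathcal B$ for which there is a norm-closed subspace $\mathcal B_*\subseteq\mathcal B^*$ with $f\cdot b,\ b\cdot f\in\mathcal B_*$ for all $f\in\mathcal B_*$, $b\in\mathcal B$, such that the natural map $\mathcal B\to(\mathcal B_*)^*$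 is a surjective isometry. For a Banach space $E$ write $B(E)$ for the Banach algebra of bounded linear operators on $E$. Then the following statements are equivalent (all spaces and algebras being over the same scalar field). (i) $\mathcal A$ is a $\mathcal{WAP}$-algebra. (ii) There are a reflexive Banach space $E$ and a continuous algebra homomorphism $\pi:\mathcal A\to B(E)$ that is bounded below. (iii) There are a dual Banach algebra $\mathcal B$ and a continuous algebra homomorphism $\phi:\mathcal A\to\mathcal B$ that is bounded below. (iv) There are a $\mathcal{WAP}$-algebra $\mathcal B$ and a continuous algebra homomorphism $\phi:\mathcal A\to\mathcal B$ that is bounded below. -/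

import Mathlib

universe u v

namespace WAPAlg

/-- A map between normed groups (used for linear maps) is bounded below if `c * ‖x‖ ≤ ‖T x‖`
for some constant `c > 0` and all `x`. -/
def BoundedBelow {X Y : Type*} [NormedAddCommGroup X] [NormedAddCommGroup Y] (T : X → Y) : Prop :=
  ∃ c : ℝ, 0 < c ∧ ∀ x, c * ‖x‖ ≤ ‖T x‖

/-- A normed space is reflexive if the canonical map into its bidual is onto. -/
def Reflexive (𝕜 E : Type*) [RCLike 𝕜] [NormedAddCommGroup E] [NormedSpace 𝕜 E] : Prop :=
  Function.Surjective (NormedSpace.inclusionInDoubleDual 𝕜 E)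

section Embedding

variable {𝕜 X : Type*} [RCLike 𝕜] [NormedAddCommGroup X] [NormedSpace 𝕜 X]

/-- A subspace `P` of the dual `X*`, as a normed space in its own right: the underlying type is
that of `P` and the norm is the one of `X*`. (It is given its own name only because instance search
is slow on a subspace of a dual space.) -/
def DualSubspace (P : Submodule 𝕜 (StrongDual 𝕜 X)) : Type _ := P

noncomputable instance (P : Submodule 𝕜 (StrongDual 𝕜 X)) : NormedAddCommGroup (DualSubspace P) :=
  inferInstanceAs (NormedAddCommGroup P)

noncomputable instance (P : Submodule 𝕜 (StrongDual 𝕜 X)) : NormedSpace 𝕜 (DualSubspace P) :=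
  inferInstanceAs (NormedSpace 𝕜 P)

/-- The isometric inclusion of a subspace `P` of `X*` into `X*`. -/
noncomputable def DualSubspace.incl (P : Submodule 𝕜 (StrongDual 𝕜 X)) :
    DualSubspace P →ₗᵢ[𝕜] StrongDual 𝕜 X :=
  P.subtypeₗᵢ

/-- The natural map `X → P*` for a subspace `P` of `X*`: it sends `x` to the functional
`f ↦ f x` on `P`. -/
noncomputable def evalOn (P : Submodule 𝕜 (StrongDual 𝕜 X)) :
    X →L[𝕜] StrongDual 𝕜 (DualSubspace P) :=
  (DualSubspace.incl P).toContinuousLinearMap.flip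

theorem evalOn_apply (P : Submodule 𝕜 (StrongDual 𝕜 X)) (x : X) (f : DualSubspace P) :
    evalOn P x f = DualSubspace.incl P f x := rfl

/-- Relative weak compactness: the closure for the weak topology is weakly compact. -/
def RelWeaklyCompact (𝕜 : Type*) {X : Type*} [RCLike 𝕜] [NormedAddCommGroup X] [NormedSpace 𝕜 X]
    (S : Set X) : Prop :=
  IsCompact (closure (toWeakSpace 𝕜 X '' S))

end Embedding

section Algebra

variable {𝕜 A : Type*} [RCLike 𝕜] [NonUnitalNormedRing A] [NormedSpace 𝕜 A]
  [IsScalarTower 𝕜 A A] [SMulCommClass 𝕜 A A]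

/-- The right module action `f · a` on the dual, `⟨f · a, b⟩ = ⟨f, a b⟩`. -/
noncomputable def rightAct (f : StrongDual 𝕜 A) (a : A) : StrongDual 𝕜 A :=
  f.comp (ContinuousLinearMap.mul 𝕜 A a)

/-- The left module action `a · f` on the dual, `⟨a · f, b⟩ = ⟨f, b a⟩`. -/
noncomputable def leftAct (a : A) (f : StrongDual 𝕜 A) : StrongDual 𝕜 A :=
  f.comp ((ContinuousLinearMap.mul 𝕜 A).flip a)

@[simp]
theorem rightAct_apply (f : StrongDual 𝕜 A) (a b : A) : rightAct f a b = f (a * b) := rfl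

@[simp]
theorem leftAct_apply (f : StrongDual 𝕜 A) (a b : A) : leftAct a f b = f (b * a) := rfl

/-- `f` is weakly almost periodic: `{f · a : ‖a‖ ≤ 1}` is relatively weakly compact in `A*`. -/
def IsWAP (f : StrongDual 𝕜 A) : Prop :=
  RelWeaklyCompact 𝕜 {g : StrongDual 𝕜 A | ∃ a : A, ‖a‖ ≤ 1 ∧ g = rightAct f a}

theorem isWAP_zero : IsWAP (0 : StrongDual 𝕜 A) := by
  have h : {g : StrongDual 𝕜 A | ∃ a : A, ‖a‖ ≤ 1 ∧ g = rightAct 0 a} = {0} := by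
    ext g
    constructor
    · rintro ⟨a, -, rfl⟩
      rfl
    · rintro rfl
      exact ⟨0, by simp, rfl⟩
  unfold IsWAP RelWeaklyCompact
  rw [h, Set.image_singleton]
  exact isCompact_singleton.closure

theorem IsWAP.add {f g : StrongDual 𝕜 A} (hf : IsWAP f) (hg : IsWAP g) : IsWAP (f + g) := by
  refine (IsCompact.add hf hg).closure_of_subset ?_
  rintro _ ⟨_, ⟨a, ha, rfl⟩, rfl⟩
  exact ⟨_, subset_closure ⟨_, ⟨a, ha, rfl⟩, rfl⟩, _, subset_closure ⟨_, ⟨a, ha, rfl⟩, rfl⟩, rfl⟩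

theorem IsWAP.smul (c : 𝕜) {f : StrongDual 𝕜 A} (hf : IsWAP f) : IsWAP (c • f) := by
  refine (IsCompact.image hf (continuous_const_smul c)).closure_of_subset ?_
  rintro _ ⟨_, ⟨a, ha, rfl⟩, rfl⟩
  exact ⟨_, subset_closure ⟨_, ⟨a, ha, rfl⟩, rfl⟩, rfl⟩

variable (𝕜 A)

/-- The space `WAP(A)` of weakly almost periodic functionals, with the norm of `A*`. -/
def WAP : Submodule 𝕜 (StrongDual 𝕜 A) where
  carrier := {f | IsWAP f}
  zero_mem' := isWAP_zero
  add_mem' := IsWAP.add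
  smul_mem' c _ hf := IsWAP.smul c hf

/-- `A` is a WAP-algebra if the natural map `A → WAP(A)*` is bounded below. -/
def IsWAPAlgebra : Prop :=
  BoundedBelow (evalOn (WAP 𝕜 A))

variable {𝕜 A}

/-- `P` is a predual of the Banach algebra `A`: a closed `A`-submodule of `A*` for which the
natural map `A → P*` is an isometric isomorphism. -/
structure IsPredual (P : Submodule 𝕜 (StrongDual 𝕜 A)) : Prop where
  isClosed : IsClosed (P : Set (StrongDual 𝕜 A))
  rightAct_mem : ∀ f ∈ P, ∀ a : A, rightAct f a ∈ P
  leftAct_mem : ∀ f ∈ P, ∀ a : A, leftAct a f ∈ P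
  isometry : Isometry (evalOn P)
  surjective : Function.Surjective (evalOn P)

variable (𝕜 A)

/-- A dual Banach algebra is a Banach algebra which has a predual. -/
def IsDualBanachAlgebra : Prop :=
  ∃ P : Submodule 𝕜 (StrongDual 𝕜 A), IsPredual P

end Algebra

end WAPAlg

/-!
The substantial implication is that a WAP-algebra `A` has a bounded below representation on a
reflexive space. For `f ∈ WAP(A)` the orbit map `a ↦ f · a` is weakly compact, so it factors through
a reflexive space by the interpolation method of Davis, Figiel, Johnson and Pełczyński. Here the
method is applied at once to the orbit maps of all `f` in the unit ball of `WAP(A)`: the space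
`InterpSpace S` of a family of operators `S f : V → X` sits in the `ℓ²`-sum over `f` and `n` of
copies of `X`, renormed so that the unit ball is `2ⁿ S f (ball V) + 2⁻ⁿ ball X`. It is reflexive
(`InterpSpace.reflexive`): an element of the bidual yields, for each `f`, an element of `X**` within
`2⁻ⁿ` of `X` up to a constant, because the second adjoint of `S f` has values in `X`; and these
elements determine the given one because functionals of finitely many coordinates are norm dense in
the dual of an `ℓ²`-sum (`exists_finset_norm_sub_sum_single_le`).

The orbit maps intertwine right multiplication on `A` with the right action on `A*`, so `A` acts on
the interpolation space from the right, hence from the left on its dual, with `‖π a‖ ≤ 2 ‖a‖`. In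
order that `|f a|` be dominated by the norm of the operator of `a` without any unit in `A`, the orbit
maps are those of the unitization. Since `A` is a WAP-algebra, these lower bounds for all `f` make the
representation bounded below. The space obtained lives in the universe of functionals on `A`; as
scalars form a small type, it is moved to the required universe by `Shrink`.

The other implications are softer. For reflexive `E` the closed span of the functionals
`T ↦ μ (T x)` is a predual of `B(E)` (`Reflexive.isPredual`). A predual consists of weakly almost
periodic functionals by the Banach–Alaoglu theorem (`IsPredual.le_wap`), so a dual Banach algebra is
a WAP-algebra. Finally weakly almost periodic functionals pull back along continuous homomorphisms
(`IsWAP.comp`), so the WAP property descends along bounded below ones.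
-/

namespace WAPAlg

/-! ### Weakly compact operators and their second adjoints -/

section WeaklyCompact

variable {𝕜 V X : Type*} [RCLike 𝕜] [NormedAddCommGroup V] [NormedSpace 𝕜 V]
  [NormedAddCommGroup X] [NormedSpace 𝕜 X]

theorem exists_eq_eval_of_weakDual (f : StrongDual 𝕜 (WeakDual 𝕜 X)) :
    ∃ x : X, ∀ φ : WeakDual 𝕜 X, f φ = φ x := by
  obtain ⟨x, hx⟩ := LinearMap.dualEmbedding_surjective (topDualPairing 𝕜 X) f
  exact ⟨x, fun φ ↦ (DFunLike.congr_fun hx φ).symm⟩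

/-- The second adjoint `S** : V** → X**` of `S` takes values in `X`. For the interpolation argument
this is the convenient form of weak compactness: it is stable under sums and compositions. -/
def BidualRange (S : V →L[𝕜] X) : Prop :=
  ∀ v : StrongDual 𝕜 (StrongDual 𝕜 V), ∃ x : X, ∀ h : StrongDual 𝕜 X, v (h.comp S) = h x

/-- The easy half of Gantmacher's theorem. By Hahn–Banach separation for the weak* topology of `X**`,
`S** v` lies in the weak* closure of `‖v‖ • S(ball V)`, which stays inside `X` because the weak
closure of `S(ball V)` is already weakly compact. -/
theorem bidualRange_of_relWeaklyCompact (S : V →L[𝕜] X)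
    (hS : RelWeaklyCompact 𝕜 (S '' Metric.closedBall 0 1)) : BidualRange S := by
  intro v
  set r : ℝ := ‖v‖
  -- `C` is `‖v‖ • S(ball V)` seen in the weak* bidual, and `z` is `S** v`.
  let C : Set (WeakDual 𝕜 (StrongDual 𝕜 X)) :=
    {φ | ∃ w : V, ‖w‖ ≤ 1 ∧ ∀ h : StrongDual 𝕜 X, φ h = (r : 𝕜) * h (S w)}
  let z : WeakDual 𝕜 (StrongDual 𝕜 X) :=
    StrongDual.toWeakDual (v.comp (ContinuousLinearMap.compL 𝕜 V X 𝕜 |>.flip S))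
  have hz (h : StrongDual 𝕜 X) : z h = v (h.comp S) := rfl
  have hC : Convex ℝ C := by
    rintro φ ⟨w, hw, hφ⟩ ψ ⟨w', hw', hψ⟩ a b ha hb hab
    refine ⟨(a : 𝕜) • w + (b : 𝕜) • w', ?_, fun h ↦ ?_⟩
    · calc ‖(a : 𝕜) • w + (b : 𝕜) • w'‖ ≤ ‖(a : 𝕜) • w‖ + ‖(b : 𝕜) • w'‖ := norm_add_le _ _
        _ = a * ‖w‖ + b * ‖w'‖ := by
          rw [norm_smul, norm_smul, RCLike.norm_ofReal, RCLike.norm_ofReal, abs_of_nonneg ha,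
            abs_of_nonneg hb]
        _ ≤ a * 1 + b * 1 := by gcongr
        _ = 1 := by simpa using hab
    · have : (a • φ + b • ψ) h = (a : 𝕜) * φ h + (b : 𝕜) * ψ h := by
        change a • φ h + b • ψ h = _
        rw [RCLike.real_smul_eq_coe_mul, RCLike.real_smul_eq_coe_mul]
      rw [this, hφ, hψ]
      simp only [map_add, map_smul, smul_eq_mul]
      ring
  let ι := NormedSpace.inclusionInDoubleDualWeak 𝕜 X
  let K : Set (WeakDual 𝕜 (StrongDual 𝕜 X)) :=
    (fun x ↦ ι ((r : 𝕜) • x)) '' closure (toWeakSpace 𝕜 X '' (S '' Metric.closedBall 0 1))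
  have hK : IsCompact K :=
    IsCompact.image hS (ι.continuous.comp (continuous_const_smul (r : 𝕜)))
  have hCK : C ⊆ K := by
    rintro φ ⟨w, hw, hφ⟩
    refine ⟨toWeakSpace 𝕜 X (S w), subset_closure ⟨_, ⟨w, by simpa using hw, rfl⟩, rfl⟩, ?_⟩
    refine DFunLike.ext _ _ fun h ↦ ?_
    rw [hφ h]
    change h ((r : 𝕜) • S w) = _
    simp
  have hzC : z ∈ closure C := by
    by_contra hn
    have : LocallyConvexSpace ℝ (WeakDual 𝕜 (StrongDual 𝕜 X)) :=
      (WeakDual.withSeminorms (𝕜 := 𝕜) (E := StrongDual 𝕜 X)).toLocallyConvexSpace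
    obtain ⟨f, u, hfu, huz⟩ := RCLike.geometric_hahn_banach_closed_point (𝕜 := 𝕜)
      hC.closure isClosed_closure hn
    obtain ⟨h, hf⟩ := exists_eq_eval_of_weakDual f
    -- `C` is balanced, so the bound on the real part is a bound on the norm of `h ∘ S`.
    have key (w : V) (hw : ‖w‖ ≤ 1) : r * ‖h (S w)‖ ≤ u := by
      obtain ⟨c, hc, hc'⟩ := RCLike.exists_norm_eq_mul_self (h (S w))
      let φ : WeakDual 𝕜 (StrongDual 𝕜 X) := ι ((r : 𝕜) • toWeakSpace 𝕜 X (S (c • w)))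
      have hφ : φ h = (r : 𝕜) * ‖h (S w)‖ := by
        change h ((r : 𝕜) • S (c • w)) = _
        rw [hc']
        simp
      have := hfu φ (subset_closure ⟨c • w, by simpa [norm_smul, hc] using hw, fun g ↦ by
        change g ((r : 𝕜) • S (c • w)) = _
        simp⟩)
      rw [hf, hφ, ← RCLike.ofReal_mul, RCLike.ofReal_re] at this
      exact this.le
    have hu : 0 ≤ u := by simpa using key 0 (by simp)
    have h2 : r * ‖h.comp S‖ ≤ u := by
      rcases (norm_nonneg v).eq_or_lt with h0 | h0
      · have : r = 0 := h0.symm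
        simpa [this] using hu
      · rw [mul_comm, ← le_div_iff₀ h0]
        refine ContinuousLinearMap.opNorm_le_of_unit_norm (div_nonneg hu h0.le) fun w hw ↦ ?_
        rw [le_div_iff₀ h0, mul_comm]
        exact key w hw.le
    have h3 : RCLike.re (z h) ≤ r * ‖h.comp S‖ :=
      (RCLike.re_le_norm _).trans (v.le_opNorm _)
    rw [hf] at huz
    linarith
  obtain ⟨x, -, hx⟩ := closure_minimal hCK hK.isClosed hzC
  refine ⟨(r : 𝕜) • (toWeakSpace 𝕜 X).symm x, fun h ↦ ?_⟩
  rw [← hz, ← hx]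
  rfl

variable {U W : Type*} [NormedAddCommGroup U] [NormedSpace 𝕜 U]
  [NormedAddCommGroup W] [NormedSpace 𝕜 W]

theorem BidualRange.add {S T : V →L[𝕜] X} (hS : BidualRange S) (hT : BidualRange T) :
    BidualRange (S + T) := by
  intro v
  obtain ⟨x, hx⟩ := hS v
  obtain ⟨y, hy⟩ := hT v
  refine ⟨x + y, fun h ↦ ?_⟩
  rw [ContinuousLinearMap.comp_add, map_add, map_add, hx, hy]

theorem BidualRange.comp_left {S : V →L[𝕜] X} (hS : BidualRange S) (T : X →L[𝕜] W) :
    BidualRange (T.comp S) := by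
  intro v
  obtain ⟨x, hx⟩ := hS v
  exact ⟨T x, fun h ↦ hx (h.comp T)⟩

theorem BidualRange.comp_right {S : V →L[𝕜] X} (hS : BidualRange S) (T : U →L[𝕜] V) :
    BidualRange (S.comp T) := fun v ↦
  hS (v.comp ((ContinuousLinearMap.compL 𝕜 U V 𝕜).flip T))

theorem bidualRange_smulRight (h : StrongDual 𝕜 V) (x : X) :
    BidualRange (h.smulRight x) := by
  intro v
  refine ⟨v h • x, fun g ↦ ?_⟩
  have : g.comp (h.smulRight x) = g x • h := by
    ext w
    simp [mul_comm]
  rw [this, map_smul, map_smul, smul_eq_mul, smul_eq_mul, mul_comm]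

end WeaklyCompact

/-! ### Functionals on `ℓ²`-sums and reflexivity of subspaces -/

section HilbertSum

open scoped ENNReal

/-- Hahn–Banach extension along a linear isometry. -/
theorem exists_extension_of_linearIsometry {𝕜 E Y : Type*} [RCLike 𝕜] [NormedAddCommGroup E]
    [NormedSpace 𝕜 E] [NormedAddCommGroup Y] [NormedSpace 𝕜 Y] (j : E →ₗᵢ[𝕜] Y)
    (μ : StrongDual 𝕜 E) : ∃ ν : StrongDual 𝕜 Y, (∀ e, ν (j e) = μ e) ∧ ‖ν‖ ≤ ‖μ‖ := by
  let ι := j.equivRange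
  obtain ⟨ν, hν, hn⟩ := exists_extension_norm_eq (LinearMap.range j.toLinearMap)
    (μ.comp (ι.symm.toContinuousLinearEquiv : LinearMap.range j.toLinearMap →L[𝕜] E))
  refine ⟨ν, fun e ↦ ?_, hn.le.trans ?_⟩
  · have h := hν (ι e)
    rwa [ContinuousLinearMap.comp_apply, ContinuousLinearEquiv.coe_coe,
      LinearIsometryEquiv.coe_toContinuousLinearEquiv, ι.symm_apply_apply] at h
  · refine ContinuousLinearMap.opNorm_le_bound _ (norm_nonneg _) fun e ↦ ?_
    simpa using μ.le_opNorm (ι.symm e)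

variable {𝕜 ι : Type*} [RCLike 𝕜] {Q : ι → Type*} [∀ i, NormedAddCommGroup (Q i)]

theorem lp_two_sum_sq_le (y : lp Q 2) (s : Finset ι) : ∑ i ∈ s, ‖y i‖ ^ 2 ≤ ‖y‖ ^ 2 := by
  simpa using lp.sum_rpow_le_norm_rpow (by simp) y s

theorem lp_two_norm_le {y : lp Q 2} {C : ℝ} (hC : 0 ≤ C)
    (h : ∀ s : Finset ι, ∑ i ∈ s, ‖y i‖ ^ 2 ≤ C ^ 2) : ‖y‖ ≤ C :=
  lp.norm_le_of_forall_sum_le (by simp) hC (by simpa using h)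

theorem memℓp_two {y : ∀ i, Q i} {C : ℝ} (h : ∀ s : Finset ι, ∑ i ∈ s, ‖y i‖ ^ 2 ≤ C) :
    Memℓp y 2 :=
  memℓp_gen' (C := C) (by simpa using h)

theorem le_sq_of_le_mul_sqrt {x c : ℝ} (hx : 0 ≤ x) (h : x ≤ c * √x) : x ≤ c ^ 2 := by
  rcases hx.eq_or_lt with rfl | hx
  · positivity
  · have h1 : √x ≤ c := by
      have h2 := Real.sqrt_pos.2 hx
      have h3 := Real.mul_self_sqrt hx.le
      by_contra! h4
      nlinarith
    calc x = √x ^ 2 := (Real.sq_sqrt hx.le).symm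
      _ ≤ c ^ 2 := by gcongr

variable [∀ i, NormedSpace 𝕜 (Q i)]

/-- The norms of the restrictions of a functional to the summands are square summable, with the
norm of the functional as a bound: half of the identification of the dual of an `ℓ²`-sum. -/
theorem sum_sq_norm_comp_single_le [DecidableEq ι] (μ : StrongDual 𝕜 (lp Q 2)) (s : Finset ι) :
    ∑ i ∈ s, ‖μ.comp (lp.singleContinuousLinearMap 𝕜 Q 2 i)‖ ^ 2 ≤ ‖μ‖ ^ 2 := by
  set a : ι → ℝ := fun i ↦ ‖μ.comp (lp.singleContinuousLinearMap 𝕜 Q 2 i)‖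
  -- The restrictions need not attain their norms; nearly norming vectors give the estimate up to
  -- a factor `δ < 1`.
  have key (δ : ℝ) (hδ : 0 < δ) (hδ1 : δ < 1) : δ ^ 2 * ∑ i ∈ s, a i ^ 2 ≤ ‖μ‖ ^ 2 := by
    have hx (i : ι) : ∃ x : Q i, ‖x‖ ≤ 1 ∧ ∃ r : ℝ, δ * a i ≤ r ∧
        μ (lp.single 2 i x) = (r : 𝕜) := by
      have h1 : ∃ x : Q i, ‖x‖ ≤ 1 ∧ δ * a i ≤ ‖μ (lp.single 2 i x)‖ := by
        rcases (norm_nonneg (μ.comp (lp.singleContinuousLinearMap 𝕜 Q 2 i))).eq_or_lt with h0 | h0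
        · have h0' : a i = 0 := h0.symm
          exact ⟨0, by simp, by simp [h0']⟩
        · obtain ⟨x, hx, hx'⟩ := ContinuousLinearMap.exists_lt_apply_of_lt_opNorm
            (μ.comp (lp.singleContinuousLinearMap 𝕜 Q 2 i)) (r := δ * a i)
            (mul_lt_of_lt_one_left h0 hδ1)
          exact ⟨x, hx.le, hx'.le⟩
      obtain ⟨x, hx, hx'⟩ := h1
      obtain ⟨c, hc, hc'⟩ := RCLike.exists_norm_eq_mul_self (μ (lp.single 2 i x))
      refine ⟨c • x, by simpa [norm_smul, hc] using hx, _, hx', ?_⟩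
      rw [lp.single_smul, map_smul, smul_eq_mul, hc']
    choose x hx1 r hr hxr using hx
    have hnorm : ‖∑ i ∈ s, lp.single (E := Q) 2 i ((a i : 𝕜) • x i)‖ ^ 2 ≤ ∑ i ∈ s, a i ^ 2 := by
      have h := lp.norm_sum_single (E := Q) (p := 2) (by simp) (fun i ↦ (a i : 𝕜) • x i) s
      simp only [ENNReal.toReal_ofNat, Real.rpow_ofNat] at h
      rw [h]
      refine Finset.sum_le_sum fun i _ ↦ ?_
      have : ‖(a i : 𝕜) • x i‖ ≤ a i := by
        rw [norm_smul, RCLike.norm_ofReal, abs_of_nonneg (norm_nonneg _)]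
        exact mul_le_of_le_one_right (norm_nonneg _) (hx1 i)
      gcongr
    have hval : μ (∑ i ∈ s, lp.single (E := Q) 2 i ((a i : 𝕜) • x i))
        = ((∑ i ∈ s, a i * r i : ℝ) : 𝕜) := by
      rw [map_sum, RCLike.ofReal_sum]
      refine Finset.sum_congr rfl fun i _ ↦ ?_
      rw [lp.single_smul, map_smul, hxr, smul_eq_mul, RCLike.ofReal_mul]
    have h1 : δ * ∑ i ∈ s, a i ^ 2 ≤ ‖μ‖ * √(∑ i ∈ s, a i ^ 2) := by
      calc δ * ∑ i ∈ s, a i ^ 2 = ∑ i ∈ s, a i * (δ * a i) := by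
            rw [Finset.mul_sum]; exact Finset.sum_congr rfl fun i _ ↦ by ring
        _ ≤ ∑ i ∈ s, a i * r i := Finset.sum_le_sum fun i _ ↦
            mul_le_mul_of_nonneg_left (hr i) (norm_nonneg _)
        _ ≤ ‖((∑ i ∈ s, a i * r i : ℝ) : 𝕜)‖ := by
            rw [RCLike.norm_ofReal]; exact le_abs_self _
        _ ≤ ‖μ‖ * ‖∑ i ∈ s, lp.single (E := Q) 2 i ((a i : 𝕜) • x i)‖ := by
            rw [← hval]; exact μ.le_opNorm _
        _ ≤ _ := by gcongr; exact Real.le_sqrt_of_sq_le hnorm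
    have h2 : ∑ i ∈ s, a i ^ 2 ≤ (‖μ‖ / δ) ^ 2 := by
      refine le_sq_of_le_mul_sqrt (by positivity) ?_
      rw [div_mul_eq_mul_div, le_div_iff₀ hδ, mul_comm]
      exact h1
    rwa [div_pow, le_div_iff₀ (by positivity), mul_comm] at h2
  have hlim : Filter.Tendsto (fun δ : ℝ ↦ δ ^ 2 * ∑ i ∈ s, a i ^ 2) (nhdsWithin 1 (Set.Iio 1))
      (nhds (1 ^ 2 * ∑ i ∈ s, a i ^ 2)) :=
    ((continuous_id.pow 2).mul continuous_const).continuousAt.tendsto.mono_left nhdsWithin_le_nhds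
  rw [one_pow, one_mul] at hlim
  refine le_of_tendsto hlim ?_
  filter_upwards [Ioo_mem_nhdsLT (zero_lt_one' ℝ)] with δ hδ using key δ hδ.1 hδ.2

/-- On an `ℓ²`-sum the functionals depending on finitely many coordinates are norm dense. -/
theorem exists_finset_norm_sub_sum_single_le [DecidableEq ι] (μ : StrongDual 𝕜 (lp Q 2)) {ε : ℝ}
    (hε : 0 < ε) : ∃ s : Finset ι, ∀ y : lp Q 2,
      ‖μ y - ∑ i ∈ s, μ (lp.single 2 i (y i))‖ ≤ ε * ‖y‖ := by
  set a : ι → ℝ := fun i ↦ ‖μ.comp (lp.singleContinuousLinearMap 𝕜 Q 2 i)‖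
  have hsum : Summable fun i ↦ a i ^ 2 :=
    summable_of_sum_le (fun i ↦ by positivity) (sum_sq_norm_comp_single_le μ)
  obtain ⟨s, hs⟩ := summable_iff_vanishing_norm.1 hsum (ε ^ 2) (by positivity)
  refine ⟨s, fun y ↦ ?_⟩
  have hy : HasSum (fun i ↦ μ (lp.single 2 i (y i))) (μ y) :=
    (lp.hasSum_single (by simp) y).mapL μ
  refine le_of_tendsto ((hy.sub_const _).norm) ?_
  filter_upwards [Filter.eventually_ge_atTop s] with t ht
  rw [← Finset.sum_sdiff ht, add_sub_cancel_right]
  have h1 : ∑ i ∈ t \ s, a i ^ 2 ≤ ε ^ 2 :=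
    (le_abs_self _).trans (hs _ Finset.sdiff_disjoint).le
  calc ‖∑ i ∈ t \ s, μ (lp.single 2 i (y i))‖
      ≤ ∑ i ∈ t \ s, a i * ‖y i‖ := norm_sum_le_of_le _ fun i _ ↦
        (μ.comp (lp.singleContinuousLinearMap 𝕜 Q 2 i)).le_opNorm (y i)
    _ ≤ √(∑ i ∈ t \ s, a i ^ 2) * √(∑ i ∈ t \ s, ‖y i‖ ^ 2) := Real.sum_mul_le_sqrt_mul_sqrt _ _ _
    _ ≤ ε * ‖y‖ := by
      gcongr
      · exact Real.sqrt_le_iff.2 ⟨hε.le, h1⟩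
      · exact Real.sqrt_le_iff.2 ⟨norm_nonneg _, lp_two_sum_sq_le y _⟩

variable {E : Type*} [NormedAddCommGroup E] [NormedSpace 𝕜 E]

/-- The `i`-th coordinate map of a space `E` embedded isometrically by `j` in an `ℓ²`-sum. -/
noncomputable def coord (j : E →ₗᵢ[𝕜] lp Q 2) (i : ι) : E →L[𝕜] Q i :=
  (lp.evalCLM 𝕜 Q 2 i).comp j.toContinuousLinearMap

/-- If `Φ ∈ E**` acts on the functionals of the single coordinates as the family `y` does, then `y`
is square summable: test `Φ` on `∑ ‖y i‖ g_i`, where `g_i` norms `y i`. -/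
theorem memℓp_of_bidual (j : E →ₗᵢ[𝕜] lp Q 2) (Φ : StrongDual 𝕜 (StrongDual 𝕜 E)) (y : ∀ i, Q i)
    (hy : ∀ i, ∀ g : StrongDual 𝕜 (Q i), Φ (g.comp (coord j i)) = g (y i)) : Memℓp y 2 := by
  refine memℓp_two (C := ‖Φ‖ ^ 2) fun s ↦ ?_
  choose g hg1 hg using fun i ↦ exists_dual_vector'' 𝕜 (y i)
  let μ : StrongDual 𝕜 E := ∑ i ∈ s, (‖y i‖ : 𝕜) • (g i).comp (coord j i)
  have hμ : ‖μ‖ ≤ √(∑ i ∈ s, ‖y i‖ ^ 2) := by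
    refine ContinuousLinearMap.opNorm_le_bound _ (Real.sqrt_nonneg _) fun e ↦ ?_
    calc ‖μ e‖ = ‖∑ i ∈ s, (‖y i‖ : 𝕜) * g i (j e i)‖ := by
          simp only [μ, sum_apply]; rfl
      _ ≤ ∑ i ∈ s, ‖y i‖ * ‖j e i‖ := norm_sum_le_of_le _ fun i _ ↦ by
          rw [norm_mul, RCLike.norm_ofReal, abs_norm]
          gcongr
          simpa using (g i).le_of_opNorm_le (hg1 i) (j e i)
      _ ≤ √(∑ i ∈ s, ‖y i‖ ^ 2) * √(∑ i ∈ s, ‖j e i‖ ^ 2) := Real.sum_mul_le_sqrt_mul_sqrt _ _ _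
      _ ≤ √(∑ i ∈ s, ‖y i‖ ^ 2) * ‖e‖ := by
          gcongr
          refine Real.sqrt_le_iff.2 ⟨norm_nonneg _, ?_⟩
          rw [← j.norm_map]
          exact lp_two_sum_sq_le _ _
  have hΦ : Φ μ = ((∑ i ∈ s, ‖y i‖ ^ 2 : ℝ) : 𝕜) := by
    rw [map_sum, RCLike.ofReal_sum]
    refine Finset.sum_congr rfl fun i _ ↦ ?_
    rw [map_smul, hy, hg, smul_eq_mul, RCLike.ofReal_pow, pow_two]
  refine le_sq_of_le_mul_sqrt (by positivity) ?_
  calc ∑ i ∈ s, ‖y i‖ ^ 2 ≤ ‖Φ μ‖ := by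
        rw [hΦ, RCLike.norm_ofReal]; exact le_abs_self _
    _ ≤ ‖Φ‖ * ‖μ‖ := Φ.le_opNorm _
    _ ≤ _ := by gcongr

/-- A subspace of an `ℓ²`-sum is reflexive as soon as every element of its bidual is represented
coordinatewise, since the functionals of finitely many coordinates are dense in its dual. -/
theorem reflexive_of_coord (j : E →ₗᵢ[𝕜] lp Q 2)
    (h : ∀ Φ : StrongDual 𝕜 (StrongDual 𝕜 E), ∃ y : ∀ i, Q i,
      (∀ i, ∀ g : StrongDual 𝕜 (Q i), Φ (g.comp (coord j i)) = g (y i)) ∧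
      ∀ hy : Memℓp y 2, (⟨y, hy⟩ : lp Q 2) ∈ Set.range j) : Reflexive 𝕜 E := by
  classical
  intro Φ
  obtain ⟨y, hy, hy'⟩ := h Φ
  obtain ⟨e, he⟩ := hy' (memℓp_of_bidual j Φ y hy)
  have hei (i : ι) : j e i = y i := by rw [he]
  refine ⟨e, ContinuousLinearMap.ext fun μ ↦ ?_⟩
  rw [NormedSpace.dual_def]
  obtain ⟨ν, hν, -⟩ := exists_extension_of_linearIsometry j μ
  refine eq_of_forall_dist_le fun δ hδ ↦ ?_
  set C : ℝ := ‖e‖ + ‖Φ‖ + 1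
  have hC : 0 < C := by positivity
  obtain ⟨s, hs⟩ := exists_finset_norm_sub_sum_single_le ν (div_pos hδ hC)
  let μs : StrongDual 𝕜 E :=
    ∑ i ∈ s, (ν.comp (lp.singleContinuousLinearMap 𝕜 Q 2 i)).comp (coord j i)
  have hμs (x : E) : μs x = ∑ i ∈ s, ν (lp.single 2 i (j x i)) := by
    simp only [μs, sum_apply]; rfl
  have hΦ : Φ μs = μs e := by
    rw [hμs, map_sum]
    refine Finset.sum_congr rfl fun i _ ↦ ?_
    rw [hy, hei]; rfl
  have h1 (x : E) : ‖(μ - μs) x‖ ≤ δ / C * ‖x‖ := by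
    have := hs (j x)
    rwa [hν, j.norm_map, ← hμs] at this
  have h2 : ‖μ - μs‖ ≤ δ / C := ContinuousLinearMap.opNorm_le_bound _ (by positivity) h1
  have h3 : μ e - Φ μ = (μ - μs) e - Φ (μ - μs) := by
    rw [map_sub, hΦ, sub_apply]; ring
  rw [dist_eq_norm, h3]
  calc ‖(μ - μs) e - Φ (μ - μs)‖ ≤ ‖(μ - μs) e‖ + ‖Φ (μ - μs)‖ := norm_sub_le _ _
    _ ≤ δ / C * ‖e‖ + ‖Φ‖ * (δ / C) :=
      add_le_add (h1 e) ((Φ.le_opNorm _).trans (by gcongr))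
    _ = δ / C * (C - 1) := by simp only [C]; ring
    _ ≤ δ / C * C := by gcongr; linarith
    _ = δ := div_mul_cancel₀ _ hC.ne'

end HilbertSum

/-! ### Renorming `X` by `2ⁿ S(ball V) + 2⁻ⁿ ball X` -/

section SumSpace

variable {𝕜 V X : Type*} [RCLike 𝕜] [NormedAddCommGroup V] [NormedSpace 𝕜 V]
  [NormedAddCommGroup X] [NormedSpace 𝕜 X]

/-- The map `(v, y) ↦ 2ⁿ S v + 2⁻ⁿ y`, whose quotient norm on `X` is that of `SumSpace S n`. -/
noncomputable def sumMap (S : V →L[𝕜] X) (n : ℕ) : V × X →L[𝕜] X :=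
  (2 ^ n : 𝕜) • S.comp (ContinuousLinearMap.fst 𝕜 V X) +
    (2 ^ n : 𝕜)⁻¹ • ContinuousLinearMap.snd 𝕜 V X

theorem sumMap_apply (S : V →L[𝕜] X) (n : ℕ) (z : V × X) :
    sumMap S n z = (2 ^ n : 𝕜) • S z.1 + (2 ^ n : 𝕜)⁻¹ • z.2 := rfl

/-- The space `X` with the equivalent norm whose open unit ball is `2ⁿ S(ball V) + 2⁻ⁿ ball X`. It is
realized as a quotient of `V × X`, which makes it a normed space without a gauge construction;
`SumSpace.toX` and `SumSpace.ofX` identify it with `X`. -/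
def SumSpace (S : V →L[𝕜] X) (n : ℕ) : Type _ := (V × X) ⧸ (sumMap S n).ker

instance isClosed_ker_sumMap (S : V →L[𝕜] X) (n : ℕ) :
    IsClosed (((sumMap S n).ker : Submodule 𝕜 (V × X)) : Set (V × X)) :=
  (sumMap S n).isClosed_ker

noncomputable instance (S : V →L[𝕜] X) (n : ℕ) : NormedAddCommGroup (SumSpace S n) :=
  inferInstanceAs (NormedAddCommGroup ((V × X) ⧸ (sumMap S n).ker))

noncomputable instance (S : V →L[𝕜] X) (n : ℕ) : NormedSpace 𝕜 (SumSpace S n) :=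
  inferInstanceAs (NormedSpace 𝕜 ((V × X) ⧸ (sumMap S n).ker))

namespace SumSpace

variable (S : V →L[𝕜] X) (n : ℕ)

/-- The quotient map from `V × X`. -/
noncomputable def mk : V × X →L[𝕜] SumSpace S n :=
  (Submodule.mkQ (sumMap S n).ker).mkContinuous 1 fun z ↦ by
    rw [one_mul]
    exact Submodule.Quotient.norm_mk_le _ z

theorem norm_mk_le (z : V × X) : ‖mk S n z‖ ≤ ‖z‖ := Submodule.Quotient.norm_mk_le _ z

theorem exists_mk_eq (q : SumSpace S n) {ε : ℝ} (hε : 0 < ε) :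
    ∃ z, mk S n z = q ∧ ‖z‖ < ‖q‖ + ε :=
  Submodule.Quotient.norm_mk_lt (S := (sumMap S n).ker) q hε

variable {S n} in
theorem mk_eq_mk {z w : V × X} (h : sumMap S n z = sumMap S n w) : mk S n z = mk S n w := by
  refine (Submodule.Quotient.eq _).2 ?_
  rw [LinearMap.mem_ker]
  change sumMap S n (z - w) = 0
  rw [map_sub, h, sub_self]

variable {S n} in
theorem norm_map_le {W : Type*} [NormedAddCommGroup W] [NormedSpace 𝕜 W]
    (T : SumSpace S n →ₗ[𝕜] W) {C : ℝ} (hC : 0 ≤ C) (h : ∀ z, ‖T (mk S n z)‖ ≤ C * ‖z‖)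
    (q : SumSpace S n) : ‖T q‖ ≤ C * ‖q‖ := by
  refine le_of_forall_pos_le_add fun ε hε ↦ ?_
  obtain ⟨z, rfl, hz⟩ := exists_mk_eq S n q (ε := ε / (C + 1)) (by positivity)
  calc ‖T (mk S n z)‖ ≤ C * ‖z‖ := h z
    _ ≤ C * (‖mk S n z‖ + ε / (C + 1)) := by gcongr
    _ = C * ‖mk S n z‖ + C / (C + 1) * ε := by ring
    _ ≤ C * ‖mk S n z‖ + 1 * ε := by
      gcongr
      rw [div_le_one (by positivity)]
      linarith
    _ = _ := by rw [one_mul]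

theorem norm_sumMap_le (z : V × X) : ‖sumMap S n z‖ ≤ (2 ^ n * ‖S‖ + 1) * ‖z‖ := by
  have h2 : ‖(2 : 𝕜)‖ = 2 := RCLike.norm_ofNat 2
  rw [sumMap_apply]
  calc ‖(2 ^ n : 𝕜) • S z.1 + (2 ^ n : 𝕜)⁻¹ • z.2‖
      ≤ 2 ^ n * ‖S z.1‖ + (2 ^ n)⁻¹ * ‖z.2‖ := by
        refine (norm_add_le _ _).trans_eq ?_
        rw [norm_smul, norm_smul, norm_inv, norm_pow, h2]
    _ ≤ 2 ^ n * (‖S‖ * ‖z‖) + 1 * ‖z‖ := by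
        gcongr
        · exact S.le_opNorm_of_le (norm_fst_le z)
        · exact inv_le_one_of_one_le₀ (one_le_pow₀ one_le_two)
        · exact norm_snd_le z
    _ = _ := by ring

/-- The identification of `SumSpace S n` with `X`. -/
noncomputable def toX : SumSpace S n →L[𝕜] X :=
  LinearMap.mkContinuous ((sumMap S n).ker.liftQ (sumMap S n).toLinearMap le_rfl)
    (2 ^ n * ‖S‖ + 1) (norm_map_le _ (by positivity) (norm_sumMap_le S n))

theorem norm_toX_le (q : SumSpace S n) : ‖toX S n q‖ ≤ (2 ^ n * ‖S‖ + 1) * ‖q‖ :=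
  norm_map_le (toX S n).toLinearMap (by positivity) (norm_sumMap_le S n) q

/-- The inverse of `SumSpace.toX`: it sends `x` to the class of `(0, 2ⁿ x)`. -/
noncomputable def ofX : X →L[𝕜] SumSpace S n :=
  (mk S n).comp ((2 ^ n : 𝕜) • ContinuousLinearMap.inr 𝕜 V X)

theorem toX_ofX (x : X) : toX S n (ofX S n x) = x := by
  change sumMap S n ((2 ^ n : 𝕜) • (0, x)) = x
  simp [sumMap_apply, smul_smul]

theorem ofX_sumMap (z : V × X) : ofX S n (sumMap S n z) = mk S n z :=
  mk_eq_mk (toX_ofX S n _)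

theorem ofX_toX (q : SumSpace S n) : ofX S n (toX S n q) = q := by
  obtain ⟨z, rfl, -⟩ := exists_mk_eq S n q one_pos
  exact ofX_sumMap S n z

theorem norm_ofX_apply_le (v : V) : ‖ofX S n (S v)‖ ≤ (2 ^ n)⁻¹ * ‖v‖ := by
  have h : sumMap S n ((2 ^ n : 𝕜)⁻¹ • v, 0) = S v := by
    simp [sumMap_apply, smul_smul]
  rw [← h, ofX_sumMap]
  refine (norm_mk_le S n _).trans_eq ?_
  simp [Prod.norm_def, norm_smul]

theorem norm_ofX_comp_toX_le {R : V →L[𝕜] V} {T : X →L[𝕜] X} {C : ℝ}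
    (hRT : ∀ v, S (R v) = T (S v)) (hR : ‖R‖ ≤ C) (hT : ‖T‖ ≤ C) (q : SumSpace S n) :
    ‖ofX S n (T (toX S n q))‖ ≤ C * ‖q‖ := by
  have hC : 0 ≤ C := (norm_nonneg _).trans hR
  refine norm_map_le ((ofX S n).comp (T.comp (toX S n))).toLinearMap hC (fun z ↦ ?_) q
  change ‖ofX S n (T (sumMap S n z))‖ ≤ _
  have h : T (sumMap S n z) = sumMap S n (R z.1, T z.2) := by
    simp [sumMap_apply, hRT]
  rw [h, ofX_sumMap]
  refine (norm_mk_le S n _).trans ?_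
  rw [Prod.norm_def]
  exact max_le ((R.le_of_opNorm_le hR _).trans (by gcongr; exact norm_fst_le z))
    ((T.le_of_opNorm_le hT _).trans (by gcongr; exact norm_snd_le z))

/-- The adjoint of the quotient map, an isometry into the dual of `V × X`. -/
noncomputable def mkDual : StrongDual 𝕜 (SumSpace S n) →ₗᵢ[𝕜] StrongDual 𝕜 (V × X) where
  toFun g := g.comp (mk S n)
  map_add' _ _ := rfl
  map_smul' _ _ := rfl
  norm_map' g := by
    refine le_antisymm ?_ ?_
    · refine ContinuousLinearMap.opNorm_le_bound _ (norm_nonneg _) fun z ↦ ?_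
      exact g.le_opNorm_of_le (norm_mk_le S n z)
    · refine ContinuousLinearMap.opNorm_le_bound _ (norm_nonneg _) fun q ↦ ?_
      exact norm_map_le g.toLinearMap (norm_nonneg _) (g.comp (mk S n)).le_opNorm q

variable {S} in
/-- If `S**` takes values in `X`, then the second adjoint of `SumSpace.toX` maps `Ψ` into
`X + 2⁻ⁿ ‖Ψ‖ ball X**`: extend `Ψ` by Hahn–Banach to the bidual of `V × X` and split it there. -/
theorem exists_bidual_decomposition (hS : BidualRange S)
    (Ψ : StrongDual 𝕜 (StrongDual 𝕜 (SumSpace S n))) :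
    ∃ (x : X) (y : StrongDual 𝕜 (StrongDual 𝕜 X)), ‖y‖ ≤ ‖Ψ‖ ∧
      ∀ h : StrongDual 𝕜 X, Ψ (h.comp (toX S n)) = h x + (2 ^ n : 𝕜)⁻¹ * y h := by
  obtain ⟨Θ, hΘ, hn⟩ := exists_extension_of_linearIsometry (mkDual S n) Ψ
  obtain ⟨x, hx⟩ := hS
    (Θ.comp ((ContinuousLinearMap.compL 𝕜 (V × X) V 𝕜).flip (ContinuousLinearMap.fst 𝕜 V X)))
  refine ⟨(2 ^ n : 𝕜) • x,
    Θ.comp ((ContinuousLinearMap.compL 𝕜 (V × X) X 𝕜).flip (ContinuousLinearMap.snd 𝕜 V X)),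
    ?_, fun h ↦ ?_⟩
  · refine ContinuousLinearMap.opNorm_le_bound _ Ψ.opNorm_nonneg fun h ↦ ?_
    refine (Θ.le_of_opNorm_le hn _).trans ?_
    gcongr
    refine ContinuousLinearMap.opNorm_le_bound _ (norm_nonneg _) fun z ↦ ?_
    exact h.le_opNorm_of_le (norm_snd_le z)
  · have h1 : mkDual S n (h.comp (toX S n)) =
        (2 ^ n : 𝕜) • (h.comp S).comp (ContinuousLinearMap.fst 𝕜 V X) +
          (2 ^ n : 𝕜)⁻¹ • h.comp (ContinuousLinearMap.snd 𝕜 V X) := by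
      ext z
      · change h (sumMap S n (z, 0)) = _
        simp [sumMap_apply]
      · change h (sumMap S n (0, z)) = _
        simp [sumMap_apply]
    rw [← hΘ, h1, map_add, map_smul, map_smul, map_smul, ← hx]
    rfl

end SumSpace

end SumSpace

theorem mem_range_of_forall_norm_sub_lt {𝕜 X Y : Type*} [RCLike 𝕜] [NormedAddCommGroup X]
    [NormedSpace 𝕜 X] [CompleteSpace X] [NormedAddCommGroup Y] [NormedSpace 𝕜 Y]
    (j : X →ₗᵢ[𝕜] Y) {z : Y} (h : ∀ ε > 0, ∃ x, ‖z - j x‖ < ε) : ∃ x, j x = z := by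
  have hcl : IsClosed (Set.range j) := j.isometry.isUniformInducing.isComplete_range.isClosed
  rw [← Set.mem_range, ← hcl.closure_eq, Metric.mem_closure_iff]
  intro ε hε
  obtain ⟨x, hx⟩ := h ε hε
  exact ⟨j x, ⟨x, rfl⟩, by rwa [dist_eq_norm]⟩

/-! ### The interpolation space of a family of operators -/

section Interpolation

variable {𝕜 F V X : Type*} [RCLike 𝕜] [NormedAddCommGroup V] [NormedSpace 𝕜 V]
  [NormedAddCommGroup X] [NormedSpace 𝕜 X]

/-- The elements of the `ℓ²`-sum of the spaces `SumSpace (S f) n` whose coordinates `(f, n)`, seen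
in `X`, do not depend on `n`. -/
noncomputable def interpSubmodule (S : F → V →L[𝕜] X) :
    Submodule 𝕜 (lp (fun i : F × ℕ ↦ SumSpace (S i.1) i.2) 2) where
  carrier := {y | ∀ f n, SumSpace.toX (S f) n (y (f, n)) = SumSpace.toX (S f) 0 (y (f, 0))}
  zero_mem' f n := by simp
  add_mem' {y z} hy hz f n := by simp [hy f n, hz f n]
  smul_mem' c y hy f n := by simp [hy f n]

/-- The Davis–Figiel–Johnson–Pełczyński interpolation space of a family of operators
`S f : V → X`: the families `(x_f)` in `X` for which the squares of the norms of `x_f` in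
`SumSpace (S f) n`, for all `f` and `n`, have a finite sum. It has a name of its own because instance
search is slow on subspaces of an `ℓ²`-sum. -/
def InterpSpace (S : F → V →L[𝕜] X) : Type _ := interpSubmodule S

noncomputable instance (S : F → V →L[𝕜] X) : NormedAddCommGroup (InterpSpace S) :=
  inferInstanceAs (NormedAddCommGroup (interpSubmodule S))

noncomputable instance (S : F → V →L[𝕜] X) : NormedSpace 𝕜 (InterpSpace S) :=
  inferInstanceAs (NormedSpace 𝕜 (interpSubmodule S))

namespace InterpSpace

variable (S : F → V →L[𝕜] X)

/-- The inclusion into the `ℓ²`-sum. -/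
noncomputable def incl :
    InterpSpace S →ₗᵢ[𝕜] lp (fun i : F × ℕ ↦ SumSpace (S i.1) i.2) 2 :=
  (interpSubmodule S).subtypeₗᵢ

/-- The `f`-th member of a family. -/
noncomputable def toX (f : F) : InterpSpace S →L[𝕜] X :=
  (SumSpace.toX (S f) 0).comp (coord (incl S) (f, 0))

theorem toX_incl (e : InterpSpace S) (f : F) (n : ℕ) :
    SumSpace.toX (S f) n (incl S e (f, n)) = toX S f e := e.2 f n

theorem incl_eq (e : InterpSpace S) (f : F) (n : ℕ) :
    incl S e (f, n) = SumSpace.ofX (S f) n (toX S f e) := by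
  rw [← toX_incl S e f n, SumSpace.ofX_toX]

theorem ext {e e' : InterpSpace S} (h : ∀ f, toX S f e = toX S f e') : e = e' := by
  refine (incl S).injective (lp.ext (funext fun i ↦ ?_))
  rw [incl_eq S e i.1 i.2, incl_eq S e' i.1 i.2, h]

theorem norm_toX_le (f : F) (e : InterpSpace S) : ‖toX S f e‖ ≤ (‖S f‖ + 1) * ‖e‖ := by
  have h1 := SumSpace.norm_toX_le (S f) 0 (incl S e (f, 0))
  have h2 : ‖incl S e (f, 0)‖ ≤ ‖e‖ := by
    rw [← (incl S).norm_map]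
    exact lp.norm_apply_le_norm two_ne_zero _ _
  rw [pow_zero, one_mul] at h1
  exact h1.trans (by gcongr)

theorem exists_of_sum_sq_le (x : F → X) {C : ℝ} (hC : 0 ≤ C)
    (h : ∀ s : Finset (F × ℕ), ∑ i ∈ s, ‖SumSpace.ofX (S i.1) i.2 (x i.1)‖ ^ 2 ≤ C ^ 2) :
    ∃ e : InterpSpace S, ‖e‖ ≤ C ∧ ∀ f, toX S f e = x f := by
  let y : lp (fun i : F × ℕ ↦ SumSpace (S i.1) i.2) 2 :=
    ⟨fun i ↦ SumSpace.ofX (S i.1) i.2 (x i.1), memℓp_two h⟩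
  have hy (i : F × ℕ) : y i = SumSpace.ofX (S i.1) i.2 (x i.1) := rfl
  refine ⟨⟨y, fun f n ↦ ?_⟩, lp_two_norm_le hC h, fun f ↦ SumSpace.toX_ofX _ _ _⟩
  rw [hy, hy, SumSpace.toX_ofX, SumSpace.toX_ofX]

/-- For `‖v‖ ≤ 1` the vector `S f v` is the `f`-th member of a family of norm at most `2`, because
its norm in `SumSpace (S f) n` is at most `2⁻ⁿ`. -/
theorem exists_single (f : F) (v : V) (hv : ‖v‖ ≤ 1) :
    ∃ e : InterpSpace S, ‖e‖ ≤ 2 ∧ toX S f e = S f v := by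
  classical
  obtain ⟨e, he, he'⟩ := exists_of_sum_sq_le S (Pi.single f (S f v)) zero_le_two fun s ↦ by
    calc ∑ i ∈ s, ‖SumSpace.ofX (S i.1) i.2 ((Pi.single f (S f v) : F → X) i.1)‖ ^ 2
        ≤ ∑ i ∈ s, (if i.1 = f then (1 / 4 : ℝ) ^ i.2 else 0) := by
          refine Finset.sum_le_sum fun i _ ↦ ?_
          split_ifs with hi
          · subst hi
            rw [Pi.single_eq_same]
            have h1 : ‖SumSpace.ofX (S i.1) i.2 (S i.1 v)‖ ≤ (2 ^ i.2)⁻¹ :=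
              (SumSpace.norm_ofX_apply_le _ _ v).trans
                (mul_le_of_le_one_right (by positivity) hv)
            calc _ ≤ ((2 ^ i.2)⁻¹ : ℝ) ^ 2 := by gcongr
              _ = _ := by rw [← inv_pow, ← pow_mul, mul_comm, pow_mul]; norm_num
          · rw [Pi.single_eq_of_ne hi, map_zero]
            simp
      _ = ∑ i ∈ s with i.1 = f, (1 / 4 : ℝ) ^ i.2 := (Finset.sum_filter _ _).symm
      _ ≤ ∑ i ∈ {f} ×ˢ s.image Prod.snd, (1 / 4 : ℝ) ^ i.2 := by
          refine Finset.sum_le_sum_of_subset_of_nonneg (fun i hi ↦ ?_) fun i _ _ ↦ by positivity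
          obtain ⟨hi, hf⟩ := Finset.mem_filter.1 hi
          exact Finset.mem_product.2 ⟨by simp [hf], Finset.mem_image_of_mem _ hi⟩
      _ = ∑ n ∈ s.image Prod.snd, (1 / 4 : ℝ) ^ n := by
          rw [Finset.sum_product]; simp
      _ ≤ ∑' n : ℕ, (1 / 4 : ℝ) ^ n :=
          (summable_geometric_of_lt_one (by norm_num) (by norm_num)).sum_le_tsum _
            fun n _ ↦ by positivity
      _ ≤ 2 ^ 2 := by
          rw [tsum_geometric_of_lt_one (by norm_num) (by norm_num)]; norm_num
  exact ⟨e, he, by rw [he', Pi.single_eq_same]⟩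

/-- An operator on `X` which lifts to `V` along every `S f` acts on the families memberwise. -/
theorem exists_operator {R : V →L[𝕜] V} {T : X →L[𝕜] X} {C : ℝ}
    (hRT : ∀ f v, S f (R v) = T (S f v)) (hR : ‖R‖ ≤ C) (hT : ‖T‖ ≤ C) :
    ∃ U : InterpSpace S →L[𝕜] InterpSpace S, ‖U‖ ≤ C ∧
      ∀ f e, toX S f (U e) = T (toX S f e) := by
  have hC : 0 ≤ C := (norm_nonneg _).trans hR
  have h (e : InterpSpace S) : ∃ e' : InterpSpace S, ‖e'‖ ≤ C * ‖e‖ ∧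
      ∀ f, toX S f e' = T (toX S f e) := by
    refine exists_of_sum_sq_le S (fun f ↦ T (toX S f e)) (by positivity) fun s ↦ ?_
    calc ∑ i ∈ s, ‖SumSpace.ofX (S i.1) i.2 (T (toX S i.1 e))‖ ^ 2
        ≤ ∑ i ∈ s, C ^ 2 * ‖incl S e i‖ ^ 2 := by
          refine Finset.sum_le_sum fun i _ ↦ ?_
          rw [← mul_pow, ← toX_incl S e i.1 i.2]
          gcongr
          exact SumSpace.norm_ofX_comp_toX_le (S i.1) i.2 (hRT i.1) hR hT _
      _ ≤ C ^ 2 * ‖e‖ ^ 2 := by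
          rw [← Finset.mul_sum, ← (incl S).norm_map]
          gcongr
          exact lp_two_sum_sq_le _ _
      _ = _ := by ring
  choose U hU hU' using h
  let L : InterpSpace S →ₗ[𝕜] InterpSpace S :=
    { toFun := U
      map_add' := fun a b ↦ ext S fun f ↦ by simp [hU']
      map_smul' := fun c a ↦ ext S fun f ↦ by simp [hU'] }
  exact ⟨L.mkContinuous C hU, L.mkContinuous_norm_le hC hU, fun f e ↦ hU' e f⟩

/-- For `Φ` in the bidual and each `f`, the functional `h ↦ Φ (h ∘ toX f)` on `X*` lies within
`2⁻ⁿ ‖Φ‖` of `X` for every `n`, hence in `X`; the resulting family represents `Φ`. -/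
theorem reflexive [CompleteSpace X] (hS : ∀ f, BidualRange (S f)) :
    Reflexive 𝕜 (InterpSpace S) := by
  refine reflexive_of_coord (incl S) fun Φ ↦ ?_
  have key (f : F) : ∃ x : X, ∀ h : StrongDual 𝕜 X, Φ (h.comp (toX S f)) = h x := by
    let z : StrongDual 𝕜 (StrongDual 𝕜 X) :=
      Φ.comp ((ContinuousLinearMap.compL 𝕜 (InterpSpace S) X 𝕜).flip (toX S f))
    obtain ⟨x, hx⟩ := mem_range_of_forall_norm_sub_lt (𝕜 := 𝕜) (X := X)
        (Y := StrongDual 𝕜 (StrongDual 𝕜 X)) (NormedSpace.inclusionInDoubleDualLi 𝕜 (E := X))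
        (z := z) fun ε hε ↦ by
      have hlim : Filter.Tendsto (fun n : ℕ ↦ ((2 : ℝ) ^ n)⁻¹ * ‖Φ‖) Filter.atTop (nhds 0) := by
        simpa [inv_pow] using (tendsto_pow_atTop_nhds_zero_of_lt_one (r := (2⁻¹ : ℝ))
          (by norm_num) (by norm_num)).mul_const ‖Φ‖
      obtain ⟨n, hn⟩ := (hlim.eventually (gt_mem_nhds hε)).exists
      let Ψ : StrongDual 𝕜 (StrongDual 𝕜 (SumSpace (S f) n)) :=
        Φ.comp ((ContinuousLinearMap.compL 𝕜 (InterpSpace S) (SumSpace (S f) n) 𝕜).flip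
          (coord (incl S) (f, n)))
      have hΨ : ‖Ψ‖ ≤ ‖Φ‖ := by
        refine ContinuousLinearMap.opNorm_le_bound _ Φ.opNorm_nonneg fun g ↦ ?_
        refine Φ.le_opNorm_of_le ?_
        refine ContinuousLinearMap.opNorm_le_bound _ (norm_nonneg _) fun e ↦ ?_
        refine g.le_opNorm_of_le ?_
        rw [← (incl S).norm_map]
        exact lp.norm_apply_le_norm two_ne_zero (incl S e) (f, n)
      obtain ⟨x, y, hy, hxy⟩ := SumSpace.exists_bidual_decomposition n (hS f) Ψ
      refine ⟨x, ?_⟩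
      have hz' : z - NormedSpace.inclusionInDoubleDualLi 𝕜 x = (2 ^ n : 𝕜)⁻¹ • y := by
        ext h
        have h1 : z h = Ψ (h.comp (SumSpace.toX (S f) n)) := by
          refine congrArg Φ (ContinuousLinearMap.ext fun e ↦ ?_)
          exact congrArg h (toX_incl S e f n).symm
        rw [sub_apply, h1, hxy]
        exact add_sub_cancel_left _ _
      rw [hz']
      refine (ContinuousLinearMap.opNorm_smul_le _ _).trans_lt (lt_of_le_of_lt ?_ hn)
      rw [norm_inv, norm_pow, RCLike.norm_ofNat]
      gcongr
      exact hy.trans hΨ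
    exact ⟨x, fun h ↦ (DFunLike.congr_fun hx h).symm⟩
  choose x hx using key
  refine ⟨fun i ↦ SumSpace.ofX (S i.1) i.2 (x i.1), fun i g ↦ ?_, fun hy ↦ ?_⟩
  · have := hx i.1 (g.comp (SumSpace.ofX (S i.1) i.2))
    rw [ContinuousLinearMap.comp_apply] at this
    rw [← this]
    refine congrArg Φ (ContinuousLinearMap.ext fun e ↦ ?_)
    exact congrArg g (incl_eq S e i.1 i.2)
  · exact ⟨⟨⟨_, hy⟩, fun f n ↦ (SumSpace.toX_ofX _ _ _).trans (SumSpace.toX_ofX _ _ _).symm⟩, rfl⟩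

end InterpSpace

end Interpolation

/-! ### Permanence of reflexivity -/

section Reflexive

variable {𝕜 E E' : Type*} [RCLike 𝕜] [NormedAddCommGroup E] [NormedSpace 𝕜 E]
  [NormedAddCommGroup E'] [NormedSpace 𝕜 E']

theorem Reflexive.strongDual (h : Reflexive 𝕜 E) : Reflexive 𝕜 (StrongDual 𝕜 E) := by
  intro Φ
  refine ⟨Φ.comp (NormedSpace.inclusionInDoubleDual 𝕜 E), ContinuousLinearMap.ext fun z ↦ ?_⟩
  obtain ⟨x, rfl⟩ := h z
  rfl

theorem Reflexive.of_linearIsometryEquiv (e : E' ≃ₗᵢ[𝕜] E) (h : Reflexive 𝕜 E) :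
    Reflexive 𝕜 E' := by
  intro Φ
  let eL : E' →L[𝕜] E := e.toContinuousLinearEquiv
  let eS : E →L[𝕜] E' := e.symm.toContinuousLinearEquiv
  obtain ⟨x, hx⟩ := h (Φ.comp ((ContinuousLinearMap.compL 𝕜 E' E 𝕜).flip eL))
  refine ⟨e.symm x, ContinuousLinearMap.ext fun g ↦ ?_⟩
  have h1 := DFunLike.congr_fun hx (g.comp eS)
  have h2 : (g.comp eS).comp eL = g := by
    ext z
    exact congrArg g (e.symm_apply_apply z)
  calc g (e.symm x) = Φ ((g.comp eS).comp eL) := h1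
    _ = Φ g := by rw [h2]

end Reflexive

/-! ### Change of universe -/

section Small

universe w

theorem small_of_rclike (𝕜 : Type*) [RCLike 𝕜] : Small.{w} 𝕜 :=
  small_of_injective (β := ℝ × ℝ) (f := fun z : 𝕜 ↦ (RCLike.re z, RCLike.im z)) fun _ _ h ↦
    RCLike.ext (Prod.ext_iff.1 h).1 (Prod.ext_iff.1 h).2

theorem small_strongDual (𝕜 E : Type*) [RCLike 𝕜] [NormedAddCommGroup E] [NormedSpace 𝕜 E]
    [Small.{w} E] : Small.{w} (StrongDual 𝕜 E) :=
  have := small_of_rclike.{w} 𝕜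
  small_of_injective (β := E → 𝕜) (f := fun φ ↦ ⇑φ) DFunLike.coe_injective

theorem InterpSpace.small {𝕜 F V X : Type*} [RCLike 𝕜] [NormedAddCommGroup V] [NormedSpace 𝕜 V]
    [NormedAddCommGroup X] [NormedSpace 𝕜 X] (S : F → V →L[𝕜] X) [Small.{w} F] [Small.{w} X] :
    Small.{w} (InterpSpace S) :=
  small_of_injective (β := F → X) (f := fun e f ↦ toX S f e) fun _ _ h ↦
    InterpSpace.ext S (congrFun h)

/-- A bounded below representation on a reflexive space can be moved to any universe which has
room for the space. -/
theorem exists_representation_shrink {𝕜 A E : Type*} [RCLike 𝕜] [NonUnitalNormedRing A]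
    [NormedSpace 𝕜 A] [NormedAddCommGroup E] [NormedSpace 𝕜 E] [CompleteSpace E] [Small.{w} E]
    (hE : Reflexive 𝕜 E) (π : A →ₙₐ[𝕜] (E →L[𝕜] E)) (hπ : Continuous π) (hπ' : BoundedBelow π) :
    ∃ (E : Type w) (_ : NormedAddCommGroup E) (_ : NormedSpace 𝕜 E) (_ : CompleteSpace E)
      (π : A →ₙₐ[𝕜] (E →L[𝕜] E)), Reflexive 𝕜 E ∧ Continuous π ∧ BoundedBelow π := by
  let e : Shrink.{w} E ≃ₗᵢ[𝕜] E := ⟨Shrink.linearEquiv 𝕜 E, fun _ ↦ rfl⟩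
  let eL : Shrink.{w} E →L[𝕜] E := e.toContinuousLinearEquiv
  let eS : E →L[𝕜] Shrink.{w} E := e.symm.toContinuousLinearEquiv
  have h1 (x : E) : eL (eS x) = x := e.apply_symm_apply x
  let ρ : A →ₙₐ[𝕜] (Shrink.{w} E →L[𝕜] Shrink.{w} E) :=
    { toFun := fun a ↦ eS.comp ((π a).comp eL)
      map_smul' := fun c a ↦ by ext x; simp
      map_zero' := by ext x; simp
      map_add' := fun a b ↦ by ext x; simp
      map_mul' := fun a b ↦ by ext x; simp [h1] }
  refine ⟨Shrink.{w} E, inferInstance, inferInstance, ?_, ρ, hE.of_linearIsometryEquiv e, ?_, ?_⟩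
  · exact (completeSpace_congr (e := e.toEquiv) e.isometry.isUniformEmbedding).2 inferInstance
  · change Continuous fun a ↦ eS.comp ((π a).comp eL)
    fun_prop
  · obtain ⟨c, hc, h⟩ := hπ'
    refine ⟨c, hc, fun a ↦ (h a).trans ?_⟩
    refine ContinuousLinearMap.opNorm_le_bound _ (norm_nonneg _) fun x ↦ ?_
    calc ‖π a x‖ = ‖ρ a (eS x)‖ := by
          change _ = ‖e.symm (π a (eL (eS x)))‖
          rw [h1, e.symm.norm_map]
      _ ≤ ‖ρ a‖ * ‖eS x‖ := (ρ a).le_opNorm _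
      _ = ‖ρ a‖ * ‖x‖ := by rw [show ‖eS x‖ = ‖x‖ from e.symm.norm_map x]

end Small

/-! ### The representation of a WAP-algebra on a reflexive space -/

/-- The adjoints of an anti-representation form a representation. -/
theorem exists_adjoint_representation {𝕜 A E : Type*} [RCLike 𝕜]
    [NonUnitalNormedRing A] [NormedSpace 𝕜 A] [NormedAddCommGroup E] [NormedSpace 𝕜 E]
    (U : A → E →L[𝕜] E) (hadd : ∀ b c, U (b + c) = U b + U c)
    (hsmul : ∀ (t : 𝕜) b, U (t • b) = t • U b) (hmul : ∀ b c, U (b * c) = (U c).comp (U b)) :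
    ∃ π : A →ₙₐ[𝕜] (StrongDual 𝕜 E →L[𝕜] StrongDual 𝕜 E), ∀ b μ, π b μ = μ.comp (U b) := by
  have hzero : U 0 = 0 := by rw [← zero_smul 𝕜 (0 : A), hsmul, zero_smul]
  refine ⟨{
    toFun := fun b ↦ (ContinuousLinearMap.compL 𝕜 E E 𝕜).flip (U b)
    map_smul' := fun t b ↦ by ext μ e; simp [hsmul]
    map_zero' := by ext μ e; simp [hzero]
    map_add' := fun b c ↦ by ext μ e; simp [hadd]
    map_mul' := fun b c ↦ by ext μ e; simp [hmul] }, fun b μ ↦ rfl⟩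

section Algebra

variable {𝕜 A : Type*} [RCLike 𝕜] [NonUnitalNormedRing A] [NormedSpace 𝕜 A]
  [IsScalarTower 𝕜 A A] [SMulCommClass 𝕜 A A]

/-- The orbit map `a ↦ f · a` of `f ∈ A*`. -/
noncomputable def orbitMap (f : StrongDual 𝕜 A) : A →L[𝕜] StrongDual 𝕜 A :=
  (ContinuousLinearMap.compL 𝕜 A A 𝕜 f).comp (ContinuousLinearMap.mul 𝕜 A)

theorem orbitMap_apply (f : StrongDual 𝕜 A) (a : A) : orbitMap f a = rightAct f a := rfl

theorem norm_rightAct_le (f : StrongDual 𝕜 A) (a : A) : ‖rightAct f a‖ ≤ ‖f‖ * ‖a‖ :=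
  (ContinuousLinearMap.opNorm_comp_le _ _).trans
    (by gcongr; exact ContinuousLinearMap.opNorm_mul_apply_le 𝕜 A a)

theorem IsWAP.bidualRange {f : StrongDual 𝕜 A} (hf : IsWAP f) : BidualRange (orbitMap f) := by
  refine bidualRange_of_relWeaklyCompact _ ?_
  have : orbitMap f '' Metric.closedBall 0 1 = {g | ∃ a : A, ‖a‖ ≤ 1 ∧ g = rightAct f a} := by
    ext g
    simp [orbitMap_apply, eq_comm]
  rw [this]
  exact hf

/-- The orbit map of the functional `(a, t) ↦ f a` on the unitization `A × 𝕜`, whose dual is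
identified with `A* × 𝕜`. The second coordinate keeps the value `f a`, which the orbit `f · a` in
`A*` may forget when `A` has no approximate identity. -/
noncomputable def unitOrbitMap (f : StrongDual 𝕜 A) : A × 𝕜 →L[𝕜] StrongDual 𝕜 A × 𝕜 :=
  ((ContinuousLinearMap.inl 𝕜 (StrongDual 𝕜 A) 𝕜).comp (orbitMap f)).comp
      (ContinuousLinearMap.fst 𝕜 A 𝕜) +
    ((ContinuousLinearMap.snd 𝕜 A 𝕜).smulRight (f, (0 : 𝕜)) +
      (f.comp (ContinuousLinearMap.fst 𝕜 A 𝕜)).smulRight ((0 : StrongDual 𝕜 A), (1 : 𝕜)))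

theorem unitOrbitMap_apply (f : StrongDual 𝕜 A) (z : A × 𝕜) :
    unitOrbitMap f z = (rightAct f z.1 + z.2 • f, f z.1) := by
  simp [unitOrbitMap, orbitMap_apply]

theorem IsWAP.bidualRange_unitOrbitMap {f : StrongDual 𝕜 A} (hf : IsWAP f) :
    BidualRange (unitOrbitMap f) :=
  ((hf.bidualRange.comp_left _).comp_right _).add
    ((bidualRange_smulRight _ _).add (bidualRange_smulRight _ _))

theorem norm_unitOrbitMap_le {f : StrongDual 𝕜 A} (hf : ‖f‖ ≤ 1) : ‖unitOrbitMap f‖ ≤ 2 := by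
  refine ContinuousLinearMap.opNorm_le_bound _ zero_le_two fun z ↦ ?_
  have h1 := norm_fst_le z
  have h2 := norm_snd_le z
  have h3 : ‖f‖ * ‖z.1‖ ≤ 1 * ‖z‖ := by gcongr
  rw [unitOrbitMap_apply, Prod.norm_def]
  refine max_le ?_ ?_
  · calc ‖rightAct f z.1 + z.2 • f‖ ≤ ‖f‖ * ‖z.1‖ + ‖z.2‖ * ‖f‖ :=
          (norm_add_le _ _).trans (add_le_add (norm_rightAct_le f z.1)
            (ContinuousLinearMap.opNorm_smul_le _ _))
      _ ≤ 1 * ‖z‖ + ‖z‖ * 1 := by gcongr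
      _ = 2 * ‖z‖ := by ring
  · calc ‖f z.1‖ ≤ ‖f‖ * ‖z.1‖ := f.le_opNorm _
      _ ≤ 1 * ‖z‖ := h3
      _ ≤ 2 * ‖z‖ := by gcongr; norm_num

/-- Right multiplication by `b ∈ A` on the unitization `A × 𝕜`. -/
noncomputable def unitMulRight (b : A) : A × 𝕜 →L[𝕜] A × 𝕜 :=
  (ContinuousLinearMap.inl 𝕜 A 𝕜).comp
    (((ContinuousLinearMap.mul 𝕜 A).flip b).comp (ContinuousLinearMap.fst 𝕜 A 𝕜) +
      (ContinuousLinearMap.snd 𝕜 A 𝕜).smulRight b)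

theorem unitMulRight_apply (b : A) (z : A × 𝕜) :
    unitMulRight b z = (z.1 * b + z.2 • b, 0) := rfl

theorem norm_unitMulRight_le (b : A) : ‖unitMulRight (𝕜 := 𝕜) b‖ ≤ 2 * ‖b‖ := by
  refine ContinuousLinearMap.opNorm_le_bound _ (by positivity) fun z ↦ ?_
  have h1 := norm_fst_le z
  have h2 := norm_snd_le z
  rw [unitMulRight_apply, Prod.norm_def, norm_zero, max_eq_left (norm_nonneg _)]
  calc ‖z.1 * b + z.2 • b‖ ≤ ‖z.1‖ * ‖b‖ + ‖z.2‖ * ‖b‖ :=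
        (norm_add_le _ _).trans (add_le_add (norm_mul_le _ _) (norm_smul_le _ _))
    _ ≤ ‖z‖ * ‖b‖ + ‖z‖ * ‖b‖ := by gcongr
    _ = 2 * ‖b‖ * ‖z‖ := by ring

/-- The right action of `b ∈ A` on the dual `A* × 𝕜` of the unitization. -/
noncomputable def unitRightAct (b : A) : StrongDual 𝕜 A × 𝕜 →L[𝕜] StrongDual 𝕜 A × 𝕜 :=
  (((ContinuousLinearMap.compL 𝕜 A A 𝕜).flip (ContinuousLinearMap.mul 𝕜 A b)).prod
    (NormedSpace.inclusionInDoubleDual 𝕜 A b)).comp (ContinuousLinearMap.fst 𝕜 (StrongDual 𝕜 A) 𝕜)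

theorem unitRightAct_apply (b : A) (z : StrongDual 𝕜 A × 𝕜) :
    unitRightAct b z = (rightAct z.1 b, z.1 b) := rfl

theorem norm_unitRightAct_le (b : A) : ‖unitRightAct (𝕜 := 𝕜) b‖ ≤ 2 * ‖b‖ := by
  refine ContinuousLinearMap.opNorm_le_bound _ (by positivity) fun z ↦ ?_
  have h : ‖z.1‖ * ‖b‖ ≤ 2 * ‖b‖ * ‖z‖ := by
    have := norm_fst_le z
    calc ‖z.1‖ * ‖b‖ ≤ ‖z‖ * ‖b‖ := by gcongr
      _ ≤ 2 * (‖z‖ * ‖b‖) := by linarith [mul_nonneg (norm_nonneg z) (norm_nonneg b)]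
      _ = _ := by ring
  rw [unitRightAct_apply, Prod.norm_def]
  exact max_le ((norm_rightAct_le _ _).trans h) ((z.1.le_opNorm b).trans h)

theorem unitOrbitMap_unitMulRight (f : StrongDual 𝕜 A) (b : A) (z : A × 𝕜) :
    unitOrbitMap f (unitMulRight b z) = unitRightAct b (unitOrbitMap f z) := by
  rw [unitOrbitMap_apply, unitRightAct_apply, unitMulRight_apply, unitOrbitMap_apply]
  refine Prod.ext (ContinuousLinearMap.ext fun c ↦ ?_) ?_
  · simp [add_mul, mul_assoc, smul_mul_assoc z.2 b c]
  · simp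

theorem unitRightAct_add (b c : A) :
    unitRightAct (𝕜 := 𝕜) (b + c) = unitRightAct b + unitRightAct c := by
  refine ContinuousLinearMap.ext fun z ↦ ?_
  refine Prod.ext (ContinuousLinearMap.ext fun a ↦ ?_) (map_add z.1 b c)
  change z.1 ((b + c) * a) = z.1 (b * a) + z.1 (c * a)
  rw [add_mul, map_add]

theorem unitRightAct_smul (t : 𝕜) (b : A) : unitRightAct (𝕜 := 𝕜) (t • b) = t • unitRightAct b := by
  refine ContinuousLinearMap.ext fun z ↦ ?_
  refine Prod.ext (ContinuousLinearMap.ext fun a ↦ ?_) (map_smul z.1 t b)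
  change z.1 (t • b * a) = t • z.1 (b * a)
  rw [smul_mul_assoc, map_smul]

theorem unitRightAct_mul (b c : A) :
    unitRightAct (𝕜 := 𝕜) (b * c) = (unitRightAct c).comp (unitRightAct b) := by
  refine ContinuousLinearMap.ext fun z ↦ ?_
  refine Prod.ext (ContinuousLinearMap.ext fun a ↦ ?_) rfl
  change z.1 (b * c * a) = z.1 (b * (c * a))
  rw [mul_assoc]

variable (𝕜 A) in
/-- The unit ball of `WAP(A)`, as an index type. -/
def WAPBall : Type _ := {f : StrongDual 𝕜 A // IsWAP f ∧ ‖f‖ ≤ 1}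

variable (𝕜 A) in
/-- The interpolation space of the orbit maps of all `f` in the unit ball of `WAP(A)`; `A` acts on
it from the right. -/
abbrev WAPSpace : Type _ := InterpSpace fun f : WAPBall 𝕜 A ↦ unitOrbitMap f.1

theorem WAPSpace.reflexive : Reflexive 𝕜 (WAPSpace 𝕜 A) :=
  InterpSpace.reflexive _ fun f ↦ f.2.1.bidualRange_unitOrbitMap

/-- A WAP-algebra has a bounded below representation on the dual of `WAPSpace 𝕜 A`. Passing to the
dual turns the right action on `WAPSpace 𝕜 A` into a left action. -/
theorem IsWAPAlgebra.exists_representation (h : IsWAPAlgebra 𝕜 A) :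
    ∃ π : A →ₙₐ[𝕜] (StrongDual 𝕜 (WAPSpace 𝕜 A) →L[𝕜] StrongDual 𝕜 (WAPSpace 𝕜 A)),
      Continuous π ∧ BoundedBelow π := by
  let S : WAPBall 𝕜 A → A × 𝕜 →L[𝕜] StrongDual 𝕜 A × 𝕜 := fun f ↦ unitOrbitMap f.1
  choose U hU hUX using fun b : A ↦ InterpSpace.exists_operator S
    (R := unitMulRight b) (T := unitRightAct b) (C := 2 * ‖b‖)
    (fun f z ↦ unitOrbitMap_unitMulRight f.1 b z) (norm_unitMulRight_le b) (norm_unitRightAct_le b)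
  have hext {P Q : WAPSpace 𝕜 A →L[𝕜] WAPSpace 𝕜 A}
      (hPQ : ∀ f e, InterpSpace.toX S f (P e) = InterpSpace.toX S f (Q e)) : P = Q :=
    ContinuousLinearMap.ext fun e ↦ InterpSpace.ext S fun f ↦ hPQ f e
  have hadd (b c : A) : U (b + c) = U b + U c := hext fun f e ↦ by
    rw [hUX, unitRightAct_add, add_apply, add_apply, map_add, hUX, hUX]
  have hsmul (t : 𝕜) (b : A) : U (t • b) = t • U b := hext fun f e ↦ by
    rw [hUX, unitRightAct_smul, smul_apply, smul_apply, map_smul, hUX]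
  have hmul (b c : A) : U (b * c) = (U c).comp (U b) := hext fun f e ↦ by
    rw [hUX, unitRightAct_mul, ContinuousLinearMap.comp_apply, ContinuousLinearMap.comp_apply,
      hUX, hUX]
  obtain ⟨π, hπ⟩ := exists_adjoint_representation U hadd hsmul hmul
  refine ⟨π, ?_, ?_⟩
  · refine AddMonoidHomClass.continuous_of_bound π 2 fun b ↦ ?_
    refine ContinuousLinearMap.opNorm_le_bound _ (by positivity) fun μ ↦ ?_
    rw [hπ, mul_comm]
    exact (ContinuousLinearMap.opNorm_comp_le _ _).trans (by gcongr; exact hU b)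
  · obtain ⟨c, hc, h⟩ := h
    refine ⟨c / 6, by positivity, fun a ↦ ?_⟩
    -- `6 = 3 * 2`: the `f`-th member of a family has norm at most `(‖S f‖ + 1) ≤ 3` times that of the
    -- family, and the family of `S f (0, 1) = (f, 0)` has norm at most `2`.
    suffices ‖evalOn (WAP 𝕜 A) a‖ ≤ 6 * ‖π a‖ by linarith [h a]
    refine ContinuousLinearMap.opNorm_le_of_unit_norm (by positivity) fun g hg ↦ ?_
    let f : WAPBall 𝕜 A :=
      ⟨DualSubspace.incl _ g, g.2, ((DualSubspace.incl _).norm_map g).le.trans hg.le⟩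
    obtain ⟨e, he, he'⟩ := InterpSpace.exists_single S f (0, 1) (by simp [Prod.norm_def])
    obtain ⟨μ, hμ, hμ'⟩ := exists_dual_vector'' 𝕜 (U a e)
    have h1 : ‖U a e‖ ≤ ‖π a‖ * 2 := by
      calc ‖U a e‖ = ‖π a μ e‖ := by
            rw [hπ, ContinuousLinearMap.comp_apply, hμ', RCLike.norm_ofReal, abs_norm]
        _ ≤ ‖π a μ‖ * ‖e‖ := (π a μ).le_opNorm e
        _ ≤ (‖π a‖ * 1) * 2 := by
            gcongr
            exact (π a).le_opNorm_of_le hμ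
        _ = ‖π a‖ * 2 := by ring
    have h2 : InterpSpace.toX S f (U a e) = (rightAct f.1 a, f.1 a) := by
      rw [hUX, he', unitRightAct_apply, unitOrbitMap_apply]
      refine Prod.ext (ContinuousLinearMap.ext fun b ↦ ?_) ?_ <;> simp
    calc ‖evalOn (WAP 𝕜 A) a g‖ = ‖f.1 a‖ := rfl
      _ ≤ ‖InterpSpace.toX S f (U a e)‖ := by rw [h2]; exact norm_snd_le (_, f.1 a)
      _ ≤ (2 + 1) * (‖π a‖ * 2) := by
          refine (InterpSpace.norm_toX_le S f _).trans ?_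
          gcongr
          exact norm_unitOrbitMap_le f.2.2
      _ = 6 * ‖π a‖ := by ring

end Algebra

theorem IsWAPAlgebra.exists_reflexive (𝕜 : Type*) [RCLike 𝕜] (A : Type u) [NonUnitalNormedRing A]
    [NormedSpace 𝕜 A] [IsScalarTower 𝕜 A A] [SMulCommClass 𝕜 A A] (h : IsWAPAlgebra 𝕜 A) :
    ∃ (E : Type (max u v)) (_ : NormedAddCommGroup E) (_ : NormedSpace 𝕜 E) (_ : CompleteSpace E)
      (π : A →ₙₐ[𝕜] (E →L[𝕜] E)), Reflexive 𝕜 E ∧ Continuous π ∧ BoundedBelow π := by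
  obtain ⟨π, hπ, hπ'⟩ := h.exists_representation
  have : Small.{max u v} 𝕜 := small_of_rclike 𝕜
  have : Small.{max u v} A := small_max.{v} A
  have : Small.{max u v} (StrongDual 𝕜 A) := small_strongDual 𝕜 A
  have : Small.{max u v} (WAPBall 𝕜 A) :=
    small_subtype (StrongDual 𝕜 A) fun f ↦ IsWAP f ∧ ‖f‖ ≤ 1
  have : Small.{max u v} (WAPSpace 𝕜 A) := InterpSpace.small _
  have : Small.{max u v} (StrongDual 𝕜 (WAPSpace 𝕜 A)) := small_strongDual 𝕜 _
  exact exists_representation_shrink WAPSpace.reflexive.strongDual π hπ hπ'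

/-! ### Dual Banach algebras are WAP-algebras -/

section Predual

variable {𝕜 A : Type*} [RCLike 𝕜] [NonUnitalNormedRing A] [NormedSpace 𝕜 A]
  [IsScalarTower 𝕜 A A] [SMulCommClass 𝕜 A A]

theorem norm_evalOn_mono {X : Type*} [NormedAddCommGroup X] [NormedSpace 𝕜 X]
    {P P' : Submodule 𝕜 (StrongDual 𝕜 X)} (h : P ≤ P') (x : X) :
    ‖evalOn P x‖ ≤ ‖evalOn P' x‖ :=
  ContinuousLinearMap.opNorm_le_bound _ (norm_nonneg _) fun g ↦
    (evalOn P' x).le_opNorm (⟨DualSubspace.incl P g, h g.2⟩ : P')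

/-- For `f ∈ P` the map `a ↦ f · a` is continuous from the weak* topology of `A = P*` to the weak
topology of `A*`, and the unit ball of `A` is weak* compact. -/
theorem IsPredual.le_wap {P : Submodule 𝕜 (StrongDual 𝕜 A)} (hP : IsPredual P) : P ≤ WAP 𝕜 A := by
  intro f hf
  choose e he using hP.surjective
  let g : WeakDual 𝕜 (DualSubspace P) → WeakSpace 𝕜 (StrongDual 𝕜 A) :=
    fun φ ↦ toWeakSpace 𝕜 _ (rightAct f (e (WeakDual.toStrongDual φ)))
  have hg : Continuous g := by
    refine WeakBilin.continuous_of_continuous_eval _ fun Φ ↦ ?_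
    obtain ⟨b, hb⟩ := hP.surjective (Φ.comp (DualSubspace.incl P).toContinuousLinearMap)
    let q : DualSubspace P := (⟨leftAct b f, hP.leftAct_mem f hf b⟩ : P)
    have key (φ : WeakDual 𝕜 (DualSubspace P)) :
        Φ (rightAct f (e (WeakDual.toStrongDual φ))) = φ q := by
      set a := e (WeakDual.toStrongDual φ) with ha
      let p : DualSubspace P := (⟨rightAct f a, hP.rightAct_mem f hf a⟩ : P)
      calc Φ (rightAct f a) = evalOn P b p := (DFunLike.congr_fun hb p).symm
        _ = evalOn P a q := rfl
        _ = WeakDual.toStrongDual φ q := by rw [ha, he]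
        _ = φ q := rfl
    exact (WeakDual.eval_continuous q).congr fun φ ↦ (key φ).symm
  have hK := (WeakDual.isCompact_closedBall (𝕜 := 𝕜) (E := DualSubspace P) 0 1).image hg
  refine hK.closure_of_subset ?_
  rintro _ ⟨_, ⟨a, ha, rfl⟩, rfl⟩
  refine ⟨StrongDual.toWeakDual (evalOn P a), ?_, ?_⟩
  · have h1 : ‖evalOn P a‖ = ‖a‖ :=
      (AddMonoidHomClass.isometry_iff_norm (evalOn P)).1 hP.isometry a
    change evalOn P a ∈ Metric.closedBall 0 1
    rw [mem_closedBall_zero_iff, h1]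
    exact ha
  · have h2 : e (evalOn P a) = a := hP.isometry.injective (he _)
    change toWeakSpace 𝕜 _ (rightAct f (e (evalOn P a))) = _
    rw [h2]

theorem IsDualBanachAlgebra.isWAPAlgebra (h : IsDualBanachAlgebra 𝕜 A) : IsWAPAlgebra 𝕜 A := by
  obtain ⟨P, hP⟩ := h
  refine ⟨1, one_pos, fun a ↦ ?_⟩
  rw [one_mul, ← (AddMonoidHomClass.isometry_iff_norm (evalOn P)).1 hP.isometry a]
  exact norm_evalOn_mono hP.le_wap a

end Predual

/-! ### Pulling back weakly almost periodic functionals -/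

section Pullback

variable {𝕜 A B : Type*} [RCLike 𝕜] [NonUnitalNormedRing A] [NormedSpace 𝕜 A]
  [IsScalarTower 𝕜 A A] [SMulCommClass 𝕜 A A] [NonUnitalNormedRing B] [NormedSpace 𝕜 B]
  [IsScalarTower 𝕜 B B] [SMulCommClass 𝕜 B B]

/-- Pulling back along a homomorphism `φ`: `(f ∘ φ) · a = (f · φ a) ∘ φ`, and composition with `φ` is
weakly continuous. -/
theorem IsWAP.comp {f : StrongDual 𝕜 B} (hf : IsWAP f) (φ : A →L[𝕜] B)
    (hφ : ∀ a b, φ (a * b) = φ a * φ b) : IsWAP (f.comp φ) := by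
  -- `‖φ‖ + 1` in place of `‖φ‖`, which may vanish.
  have hr : 0 < ‖φ‖ + 1 := by positivity
  have hr' : ((‖φ‖ + 1 : ℝ) : 𝕜) ≠ 0 := RCLike.ofReal_ne_zero.2 hr.ne'
  let Ψ : StrongDual 𝕜 B →L[𝕜] StrongDual 𝕜 A := (ContinuousLinearMap.compL 𝕜 A B 𝕜).flip φ
  refine (IsCompact.image hf ((WeakSpace.map Ψ).continuous.comp
    (continuous_const_smul ((‖φ‖ + 1 : ℝ) : 𝕜)))).closure_of_subset ?_
  rintro _ ⟨_, ⟨a, ha, rfl⟩, rfl⟩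
  let b : B := ((‖φ‖ + 1 : ℝ) : 𝕜)⁻¹ • φ a
  have hb : ‖b‖ ≤ 1 := by
    rw [norm_smul, norm_inv, RCLike.norm_ofReal, abs_of_pos hr, inv_mul_le_iff₀ hr]
    calc ‖φ a‖ ≤ ‖φ‖ * 1 := φ.le_opNorm_of_le ha
      _ ≤ (‖φ‖ + 1) * 1 := by linarith
  refine ⟨toWeakSpace 𝕜 _ (rightAct f b), subset_closure ⟨_, ⟨b, hb, rfl⟩, rfl⟩, ?_⟩
  refine congrArg (toWeakSpace 𝕜 (StrongDual 𝕜 A)) (ContinuousLinearMap.ext fun c ↦ ?_)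
  change ((‖φ‖ + 1 : ℝ) : 𝕜) • f (((‖φ‖ + 1 : ℝ) : 𝕜)⁻¹ • φ a * φ c) = f (φ (a * c))
  rw [smul_mul_assoc, map_smul, smul_smul, mul_inv_cancel₀ hr', one_smul, hφ]

theorem IsWAPAlgebra.of_boundedBelow (h : IsWAPAlgebra 𝕜 B) (φ : A →ₙₐ[𝕜] B)
    (hφ : Continuous φ) (hφ' : BoundedBelow φ) : IsWAPAlgebra 𝕜 A := by
  let φL : A →L[𝕜] B := ⟨(φ : A →ₗ[𝕜] B), hφ⟩
  have hmul (a b : A) : φL (a * b) = φL a * φL b := map_mul φ a b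
  obtain ⟨c, hc, h⟩ := h
  obtain ⟨d, hd, h'⟩ := hφ'
  have hr : 0 < ‖φL‖ + 1 := by positivity
  refine ⟨c * d / (‖φL‖ + 1), by positivity, fun a ↦ ?_⟩
  have h1 : ‖evalOn (WAP 𝕜 B) (φ a)‖ ≤ (‖φL‖ + 1) * ‖evalOn (WAP 𝕜 A) a‖ := by
    refine ContinuousLinearMap.opNorm_le_bound _ (by positivity) fun g ↦ ?_
    let p : DualSubspace (WAP 𝕜 A) :=
      (⟨(DualSubspace.incl _ g).comp φL, IsWAP.comp g.2 φL hmul⟩ : WAP 𝕜 A)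
    have hp : ‖p‖ ≤ ‖g‖ * ‖φL‖ :=
      (ContinuousLinearMap.opNorm_comp_le (DualSubspace.incl _ g) φL).trans_eq rfl
    calc ‖evalOn (WAP 𝕜 B) (φ a) g‖ = ‖evalOn (WAP 𝕜 A) a p‖ := rfl
      _ ≤ ‖evalOn (WAP 𝕜 A) a‖ * ‖p‖ := ContinuousLinearMap.le_opNorm _ _
      _ ≤ ‖evalOn (WAP 𝕜 A) a‖ * (‖g‖ * (‖φL‖ + 1)) := by
          gcongr
          exact hp.trans (by gcongr; linarith)
      _ = _ := by ring
  rw [div_mul_eq_mul_div, div_le_iff₀ hr, mul_comm _ (‖φL‖ + 1)]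
  calc c * d * ‖a‖ = c * (d * ‖a‖) := mul_assoc _ _ _
    _ ≤ c * ‖φ a‖ := by gcongr; exact h' a
    _ ≤ ‖evalOn (WAP 𝕜 B) (φ a)‖ := h _
    _ ≤ _ := h1

end Pullback

/-! ### The predual of `B(E)` for reflexive `E` -/

section Operators

variable {𝕜 E : Type*} [RCLike 𝕜] [NormedAddCommGroup E] [NormedSpace 𝕜 E]

variable (𝕜 E) in
/-- The functional `T ↦ μ (T x)` on `B(E)`, as a bilinear map in `x` and `μ`. -/
noncomputable def matrixCoeff :
    E →L[𝕜] StrongDual 𝕜 E →L[𝕜] StrongDual 𝕜 (E →L[𝕜] E) :=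
  (ContinuousLinearMap.compL 𝕜 (E →L[𝕜] E) E 𝕜).flip.comp (ContinuousLinearMap.apply 𝕜 E)

theorem norm_matrixCoeff_le (x : E) (μ : StrongDual 𝕜 E) : ‖matrixCoeff 𝕜 E x μ‖ ≤ ‖x‖ * ‖μ‖ := by
  refine ContinuousLinearMap.opNorm_le_bound _ (by positivity) fun T ↦ ?_
  calc ‖μ (T x)‖ ≤ ‖μ‖ * (‖T‖ * ‖x‖) := μ.le_opNorm_of_le (T.le_opNorm x)
    _ = _ := by ring

variable (𝕜 E) in
/-- The closed span of the functionals `T ↦ μ (T x)`: the predual of `B(E)` for reflexive `E`. -/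
noncomputable def coeffSubmodule : Submodule 𝕜 (StrongDual 𝕜 (E →L[𝕜] E)) :=
  (Submodule.span 𝕜 {f | ∃ x μ, f = matrixCoeff 𝕜 E x μ}).topologicalClosure

theorem matrixCoeff_mem (x : E) (μ : StrongDual 𝕜 E) : matrixCoeff 𝕜 E x μ ∈ coeffSubmodule 𝕜 E :=
  Submodule.le_topologicalClosure _ (Submodule.subset_span ⟨x, μ, rfl⟩)

theorem coeffSubmodule_le {P : Submodule 𝕜 (StrongDual 𝕜 (E →L[𝕜] E))}
    (hP : IsClosed (P : Set (StrongDual 𝕜 (E →L[𝕜] E)))) (h : ∀ x μ, matrixCoeff 𝕜 E x μ ∈ P) :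
    coeffSubmodule 𝕜 E ≤ P :=
  Submodule.topologicalClosure_minimal _
    (Submodule.span_le.2 (by rintro _ ⟨x, μ, rfl⟩; exact h x μ)) hP

theorem mem_coeffSubmodule_of_map
    (L : StrongDual 𝕜 (E →L[𝕜] E) →L[𝕜] StrongDual 𝕜 (E →L[𝕜] E))
    (h : ∀ x μ, L (matrixCoeff 𝕜 E x μ) ∈ coeffSubmodule 𝕜 E) {f : StrongDual 𝕜 (E →L[𝕜] E)}
    (hf : f ∈ coeffSubmodule 𝕜 E) : L f ∈ coeffSubmodule 𝕜 E :=
  coeffSubmodule_le (P := (coeffSubmodule 𝕜 E).comap L.toLinearMap)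
    ((Submodule.isClosed_topologicalClosure _).preimage L.continuous) h hf

theorem norm_evalOn_coeffSubmodule (T : E →L[𝕜] E) : ‖evalOn (coeffSubmodule 𝕜 E) T‖ = ‖T‖ := by
  refine le_antisymm ?_ ?_
  · refine ContinuousLinearMap.opNorm_le_bound _ (norm_nonneg _) fun g ↦ ?_
    rw [mul_comm]
    exact (DualSubspace.incl _ g).le_opNorm T
  · refine ContinuousLinearMap.opNorm_le_bound _ (norm_nonneg _) fun x ↦ ?_
    obtain ⟨μ, hμ, hμ'⟩ := exists_dual_vector'' 𝕜 (T x)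
    let p : DualSubspace (coeffSubmodule 𝕜 E) :=
      (⟨matrixCoeff 𝕜 E x μ, matrixCoeff_mem x μ⟩ : coeffSubmodule 𝕜 E)
    have hp : ‖p‖ ≤ ‖x‖ * 1 := (norm_matrixCoeff_le x μ).trans (by gcongr)
    calc ‖T x‖ = ‖μ (T x)‖ := by rw [hμ', RCLike.norm_ofReal, abs_norm]
      _ = ‖evalOn (coeffSubmodule 𝕜 E) T p‖ := rfl
      _ ≤ _ := (evalOn (coeffSubmodule 𝕜 E) T).le_opNorm_of_le (hp.trans_eq (mul_one _))

/-- On a reflexive space every bounded bilinear form on `E × E*` is `(x, μ) ↦ μ (T x)` for an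
operator `T`. -/
theorem Reflexive.exists_operator (hE : Reflexive 𝕜 E) {W : Type*} [NormedAddCommGroup W]
    [NormedSpace 𝕜 W] (m : E →L[𝕜] StrongDual 𝕜 E →L[𝕜] W) (Φ : StrongDual 𝕜 W) :
    ∃ T : E →L[𝕜] E, ∀ x μ, Φ (m x μ) = μ (T x) := by
  let J : E ≃ₗᵢ[𝕜] StrongDual 𝕜 (StrongDual 𝕜 E) :=
    LinearIsometryEquiv.ofSurjective (NormedSpace.inclusionInDoubleDualLi 𝕜) hE
  let JS : StrongDual 𝕜 (StrongDual 𝕜 E) →L[𝕜] E := J.symm.toContinuousLinearEquiv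
  refine ⟨JS.comp ((ContinuousLinearMap.compL 𝕜 (StrongDual 𝕜 E) W 𝕜 Φ).comp m), fun x μ ↦ ?_⟩
  exact (DFunLike.congr_fun (J.apply_symm_apply (Φ.comp (m x))) μ).symm

theorem Reflexive.isPredual (hE : Reflexive 𝕜 E) : IsPredual (coeffSubmodule 𝕜 E) where
  isClosed := Submodule.isClosed_topologicalClosure _
  rightAct_mem f hf T := mem_coeffSubmodule_of_map
    ((ContinuousLinearMap.compL 𝕜 (E →L[𝕜] E) (E →L[𝕜] E) 𝕜).flip
      (ContinuousLinearMap.mul 𝕜 (E →L[𝕜] E) T))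
    (fun x μ ↦ matrixCoeff_mem x (μ.comp T)) hf
  leftAct_mem f hf T := mem_coeffSubmodule_of_map
    ((ContinuousLinearMap.compL 𝕜 (E →L[𝕜] E) (E →L[𝕜] E) 𝕜).flip
      ((ContinuousLinearMap.mul 𝕜 (E →L[𝕜] E)).flip T))
    (fun x μ ↦ matrixCoeff_mem (T x) μ) hf
  isometry := AddMonoidHomClass.isometry_of_norm _ norm_evalOn_coeffSubmodule
  surjective φ := by
    obtain ⟨Φ, hΦ, -⟩ := exists_extension_of_linearIsometry (DualSubspace.incl _) φ
    obtain ⟨T, hT⟩ := hE.exists_operator (matrixCoeff 𝕜 E) Φ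
    refine ⟨T, ContinuousLinearMap.ext fun g ↦ ?_⟩
    rw [← hΦ, evalOn_apply]
    let D : StrongDual 𝕜 (StrongDual 𝕜 (E →L[𝕜] E)) :=
      Φ - NormedSpace.inclusionInDoubleDual 𝕜 (E →L[𝕜] E) T
    have h0 : coeffSubmodule 𝕜 E ≤ D.ker :=
      coeffSubmodule_le D.isClosed_ker fun x μ ↦ sub_eq_zero.2 (hT x μ)
    exact (sub_eq_zero.1 (h0 g.2)).symm

end Operators

end WAPAlg

theorem proposition2p1 (𝕜 : Type*) [RCLike 𝕜] (A : Type u) [NonUnitalNormedRing A]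
    [NormedSpace 𝕜 A] [IsScalarTower 𝕜 A A] [SMulCommClass 𝕜 A A] [CompleteSpace A] :
    List.TFAE [
      WAPAlg.IsWAPAlgebra 𝕜 A,
      ∃ (E : Type (max u v)) (_ : NormedAddCommGroup E) (_ : NormedSpace 𝕜 E)
        (_ : CompleteSpace E) (π : A →ₙₐ[𝕜] (E →L[𝕜] E)),
        WAPAlg.Reflexive 𝕜 E ∧ Continuous π ∧ WAPAlg.BoundedBelow π,
      ∃ (B : Type (max u v)) (_ : NonUnitalNormedRing B) (_ : NormedSpace 𝕜 B)
        (_ : IsScalarTower 𝕜 B B) (_ : SMulCommClass 𝕜 B B) (_ : CompleteSpace B)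
        (φ : A →ₙₐ[𝕜] B),
        WAPAlg.IsDualBanachAlgebra 𝕜 B ∧ Continuous φ ∧ WAPAlg.BoundedBelow φ,
      ∃ (B : Type (max u v)) (_ : NonUnitalNormedRing B) (_ : NormedSpace 𝕜 B)
        (_ : IsScalarTower 𝕜 B B) (_ : SMulCommClass 𝕜 B B) (_ : CompleteSpace B)
        (φ : A →ₙₐ[𝕜] B),
        WAPAlg.IsWAPAlgebra 𝕜 B ∧ Continuous φ ∧ WAPAlg.BoundedBelow φ] := by
  tfae_have 1 → 2 := WAPAlg.IsWAPAlgebra.exists_reflexive.{u, v} 𝕜 A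
  tfae_have 2 → 3 := by
    rintro ⟨E, _, _, _, π, hE, hπ⟩
    exact ⟨E →L[𝕜] E, inferInstance, inferInstance, inferInstance, inferInstance, inferInstance, π,
      ⟨_, hE.isPredual⟩, hπ⟩
  tfae_have 3 → 4 := by
    rintro ⟨B, _, _, _, _, _, φ, hB, hφ⟩
    exact ⟨B, inferInstance, inferInstance, inferInstance, inferInstance, inferInstance, φ,
      hB.isWAPAlgebra, hφ⟩
  tfae_have 4 → 1 := by
    rintro ⟨B, _, _, _, _, _, φ, hB, hφ, hφ'⟩
    exact hB.of_boundedBelow φ hφ hφ'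
  tfae_finish
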